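/- Let $N$ be a smooth finite-dimensional manifold without boundary and let $k\ge 1$. Let $M=\Lambda^kT^*N$ be the total space of the bundle of alternating $k$-forms on the tangent spaces of $N$, with projection $\pi\colon M\to N$. Let $\theta\in\Omega^k(M)$ be minus the canonical (tautological) $k$-form, i.e. $\theta_p(v_1,\dots,v_k)=-p(d\pi(v_1),\dots,d\pi(v_k))$ for $p\in M$ and $v_1,\dots,v_k\in T_pM$. Let $b\in\Omega^k(N)$, $a\in\Omega^{k-1}(N)$ and let $w$ be a vector field on $N$ (all smooth) such that $\mathcal L_w b=da$. Let $w^h$ be the canonical lift of $w$ to $M$, i.e. the generator of the flow $(\phi_t^{-1})^*$ on $M$ induced by the (local) flow $\phi_t$ of $w$; in local coordinates it has the component $w$ along the base and the component $-\sum_{i}p(\cdot,\dots,Dw(\cdot),\dots,\cdot)$ ($Dw$ applied to the $i$-th argument) along the fibre over the point $p$. Put $$\omega=d\theta+\pi^*db\in\Omega^{k+1}(M),\qquad H=-\pi^*a+\iota_{w^h}(\theta+\pi^*b)\in\Omega^{k-1}(M).$$ Then: 1. $\omega$ is a smooth closed $(k+1)$-form (it is pre-$k$-plectic), and if $k\le\dim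 N$ it is $k$-plectic, i.e. moreover for every $p\in M$ the map $T_pM\to\Lambda^kT_p^*M$, $v\mapsto\iota_v\omega_p$, is injective. 2. $w^h$ is a smooth vector field, $H$ is a smooth $(k-1)$-form, and $dH=-\iota_{w^h}\omega$; that is, $w^h$ is a Hamiltonian vector field on $(M,\omega)$ with Hamiltonian $(k-1)$-form $H$. -/

import Mathlib

open Bundle Set
open scoped Manifold ContDiff

noncomputable section

namespace Multisymplectic

/-! ### The bundle of alternating `k`-forms on the tangent spaces is a smooth vector bundle -/

section SmoothComposition

variable {V W : Type*} [NormedAddCommGroup V] [NormedSpace ℝ V]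
  [NormedAddCommGroup W] [NormedSpace ℝ W] {k : ℕ}

theorem norm_alternatization_le (f : ContinuousMultilinearMap ℝ (fun _ : Fin k => V) ℝ) :
    ‖ContinuousMultilinearMap.alternatization f‖ ≤ (k.factorial : ℝ) * ‖f‖ := by
  refine ContinuousAlternatingMap.opNorm_le_bound _ (by positivity) fun v => ?_
  rw [ContinuousMultilinearMap.alternatization_apply_apply]
  calc _ ≤ ∑ σ : Equiv.Perm (Fin k), ‖f‖ * ∏ i, ‖v i‖ := by
        refine norm_sum_le_of_le _ fun σ _ => ?_
        have h := f.le_opNorm (v ∘ σ)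
        have h2 : ∏ i, ‖(v ∘ σ) i‖ = ∏ i, ‖v i‖ := Equiv.prod_comp σ (fun i => ‖v i‖)
        rw [h2] at h
        rcases Int.units_eq_one_or (Equiv.Perm.sign σ) with hs | hs <;> rw [hs] <;> simpa using h
    _ = _ := by simp [Fintype.card_perm, mul_assoc]

/-- Precomposition of alternating forms with a linear map `A` depends smoothly on `A`. -/
theorem contDiff_compContinuousLinearMapCLM {n : WithTop ℕ∞} :
    ContDiff ℝ n (fun A : V →L[ℝ] W =>
      (ContinuousAlternatingMap.compContinuousLinearMapCLM A :
        (W [⋀^Fin k]→L[ℝ] ℝ) →L[ℝ] (V [⋀^Fin k]→L[ℝ] ℝ))) := by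
  let alt : ContinuousMultilinearMap ℝ (fun _ : Fin k => V) ℝ →L[ℝ] (V [⋀^Fin k]→L[ℝ] ℝ) :=
    AddMonoidHom.toRealLinearMap ContinuousMultilinearMap.alternatization
      (AddMonoidHomClass.continuous_of_bound _ _ norm_alternatization_le)
  let tm : (W [⋀^Fin k]→L[ℝ] ℝ) →L[ℝ] ContinuousMultilinearMap ℝ (fun _ : Fin k => W) ℝ :=
    ContinuousAlternatingMap.toContinuousMultilinearMapCLM ℝ
  let Q := ContinuousMultilinearMap.compContinuousLinearMapContinuousMultilinear ℝ
    (fun _ : Fin k => V) (fun _ : Fin k => W) ℝ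
  have key : (fun A : V →L[ℝ] W =>
      (ContinuousAlternatingMap.compContinuousLinearMapCLM A :
        (W [⋀^Fin k]→L[ℝ] ℝ) →L[ℝ] (V [⋀^Fin k]→L[ℝ] ℝ))) =
      fun A => (((k.factorial : ℝ)⁻¹) • alt) ∘L (Q (fun _ => A)) ∘L tm := by
    funext A
    ext η v
    have h : alt (Q (fun _ => A) (tm η)) = k.factorial • η.compContinuousLinearMap A := by
      have h1 := AlternatingMap.coe_alternatization (η.compContinuousLinearMap A).toAlternatingMap
      rw [Fintype.card_fin] at h1
      ext u
      have h2 := congrArg (fun g => g u) h1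
      simp only [MultilinearMap.alternatization_apply] at h2
      change ContinuousMultilinearMap.alternatization ((Q fun _ => A) (tm η)) u = _
      rw [ContinuousMultilinearMap.alternatization_apply_apply]
      refine Eq.trans ?_ (h2.trans ?_)
      · exact Finset.sum_congr rfl fun σ _ => rfl
      · simp
    have hk : (k.factorial : ℝ) ≠ 0 := by positivity
    simp [h, hk]
  rw [key]
  refine contDiff_const.clm_comp (ContDiff.clm_comp ?_ contDiff_const)
  have hQ : ContDiff ℝ n Q := by
    exact ContinuousMultilinearMap.contDiff (𝕜 := ℝ) (E := fun _ : Fin k => V →L[ℝ] W)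
      (F := ContinuousMultilinearMap ℝ (fun _ : Fin k => W) ℝ →L[ℝ]
        ContinuousMultilinearMap ℝ (fun _ : Fin k => V) ℝ) Q
  exact hQ.comp (contDiff_pi.2 fun _ => contDiff_id)

end SmoothComposition

section FormBundle

variable {E H : Type*} [NormedAddCommGroup E] [NormedSpace ℝ E] [TopologicalSpace H]
  (I : ModelWithCorners ℝ E H) (M : Type*) [TopologicalSpace M] [ChartedSpace H M]

/-- The total space of `Λ^k T^*M`, the bundle whose fibre at `x` consists of the alternating
`k`-linear forms on `T_x M`. Topology and charts are those of Mathlib's bundle of alternating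
maps. -/
abbrev FormBundle (k : ℕ) :=
  TotalSpace (E [⋀^Fin k]→L[ℝ] ℝ) (fun x : M => TangentSpace I x [⋀^Fin k]→L[ℝ] ℝ)

/-- The model with corners of the manifold `Λ^k T^*M`. -/
abbrev formModel (k : ℕ) : ModelWithCorners ℝ (E × (E [⋀^Fin k]→L[ℝ] ℝ))
    (ModelProd H (E [⋀^Fin k]→L[ℝ] ℝ)) :=
  I.prod 𝓘(ℝ, E [⋀^Fin k]→L[ℝ] ℝ)

/-- `Λ^k T^*M` is a smooth vector bundle; hence its total space is a smooth manifold. -/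
instance contMDiffVectorBundle_forms [IsManifold I ∞ M] (k : ℕ) :
    ContMDiffVectorBundle ∞ (E [⋀^Fin k]→L[ℝ] ℝ)
      (fun x : M => TangentSpace I x [⋀^Fin k]→L[ℝ] ℝ) I := by
  have : (Bundle.ContinuousAlternatingMap.vectorPrebundle ℝ (Fin k) E
      (TangentSpace I : M → Type _) ℝ (Bundle.Trivial M ℝ)).IsContMDiff I ∞ := by
    constructor
    rintro _ ⟨e₁, e₂, he₁, he₂, rfl⟩ _ ⟨e₁', e₂', he₁', he₂', rfl⟩
    refine ⟨Pretrivialization.continuousAlternatingMapCoordChange ℝ (Fin k) e₁ e₁' e₂ e₂', ?_,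
      Pretrivialization.continuousAlternatingMapCoordChange_apply⟩
    simp +unfoldPartialApp only [Pretrivialization.continuousAlternatingMapCoordChange,
      ContinuousLinearEquiv.coe_continuousAlternatingMapCongr, ContinuousLinearEquiv.symm_symm]
    refine ContMDiffOn.clm_comp ?_ ?_
    · have h := (contMDiffOn_coordChangeL (n := ∞) (IB := I) e₂ e₂')
      have hc : ContDiff ℝ ∞ (fun A : ℝ →L[ℝ] ℝ =>
          (ContinuousLinearMap.compContinuousAlternatingMapCLM (ι := Fin k) ℝ E ℝ ℝ A :
            (E [⋀^Fin k]→L[ℝ] ℝ) →L[ℝ] (E [⋀^Fin k]→L[ℝ] ℝ))) := by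
        exact ContinuousLinearMap.contDiff (𝕜 := ℝ) (E := ℝ →L[ℝ] ℝ)
          (F := (E [⋀^Fin k]→L[ℝ] ℝ) →L[ℝ] (E [⋀^Fin k]→L[ℝ] ℝ))
          (ContinuousLinearMap.compContinuousAlternatingMapCLM (ι := Fin k) ℝ E ℝ ℝ)
      exact (hc.contMDiff.comp_contMDiffOn h).mono fun y hy => ⟨hy.1.2, hy.2.2⟩
    · have h := (contMDiffOn_coordChangeL (n := ∞) (IB := I) e₁' e₁)
      exact (contDiff_compContinuousLinearMapCLM.contMDiff.comp_contMDiffOn h).mono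
        fun y hy => ⟨hy.2.1, hy.1.1⟩
  exact (Bundle.ContinuousAlternatingMap.vectorPrebundle ℝ (Fin k) E
    (TangentSpace I : M → Type _) ℝ (Bundle.Trivial M ℝ)).contMDiffVectorBundle I

end FormBundle

/-! ### Vector fields, differential forms and their calculus -/

section Calculus

variable {E H : Type*} [NormedAddCommGroup E] [NormedSpace ℝ E] [TopologicalSpace H]
  (I : ModelWithCorners ℝ E H) {M : Type*} [TopologicalSpace M] [ChartedSpace H M]
  {E' H' : Type*} [NormedAddCommGroup E'] [NormedSpace ℝ E'] [TopologicalSpace H']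
  (I' : ModelWithCorners ℝ E' H') {M' : Type*} [TopologicalSpace M'] [ChartedSpace H' M']
  {k : ℕ}

variable (M) in
/-- A (not necessarily smooth) vector field on `M`. -/
abbrev VField := Π x : M, TangentSpace I x

variable (M) in
/-- A (not necessarily smooth) differential `k`-form on `M`. -/
abbrev DForm (k : ℕ) := Π x : M, TangentSpace I x [⋀^Fin k]→L[ℝ] ℝ

/-- Smoothness of a vector field, as a section of the tangent bundle. -/
def IsSmoothField [IsManifold I ∞ M] (w : VField I M) : Prop :=
  ContMDiff I I.tangent ∞ (fun x => (⟨x, w x⟩ : TangentBundle I M))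

/-- Smoothness of a `k`-form, as a section of `Λ^k T^*M`. -/
def IsSmoothForm [IsManifold I ∞ M] (α : DForm I M k) : Prop :=
  ContMDiff I (formModel I k) ∞ (fun x => (⟨x, α x⟩ : FormBundle I M k))

/-- The pullback `f^* α`. -/
def pullback (f : M → M') (α : DForm I' M' k) : DForm I M k :=
  fun x => (α (f x)).compContinuousLinearMap (mfderiv I I' f x)

/-- Insertion of a vector in the first slot of an alternating form. -/
def insertVector {V : Type*} [AddCommGroup V] [Module ℝ V] [TopologicalSpace V]
    (v : V) (η : V [⋀^Fin (k + 1)]→L[ℝ] ℝ) : V [⋀^Fin k]→L[ℝ] ℝ :=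
  { η.toAlternatingMap.curryLeft v with
    cont := η.cont.comp (continuous_const.matrixVecCons continuous_id) }

/-- The interior product `ι_w α`, with `(ι_w α)(v₁, …, v_k) = α(w, v₁, …, v_k)`. -/
def interior (w : VField I M) (α : DForm I M (k + 1)) : DForm I M k :=
  fun x => insertVector (w x) (α x)

/-- The form `α` read in the preferred chart around `x`, i.e. its pullback under the inverse of the
chart. -/
def chartForm (x : M) (α : DForm I M k) : E → E [⋀^Fin k]→L[ℝ] ℝ :=
  fun y => (α ((extChartAt I x).symm y)).compContinuousLinearMap
    (mfderivWithin 𝓘(ℝ, E) I (extChartAt I x).symm (range I) y)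

/-- The vector field `w` read in the preferred chart around `x`. -/
def chartField (x : M) (w : VField I M) : E → E :=
  VectorField.mpullbackWithin 𝓘(ℝ, E) I (extChartAt I x).symm w (range I)

/-- The alternating form on `T_x M` with a given expression in the preferred chart around `x`. -/
def ofChart (x : M) (η : E [⋀^Fin k]→L[ℝ] ℝ) : TangentSpace I x [⋀^Fin k]→L[ℝ] ℝ :=
  η.compContinuousLinearMap (mfderiv I 𝓘(ℝ, E) (extChartAt I x) x)

/-- The exterior derivative: `(dα)_x` is computed in the chart around `x`. -/
def extD (α : DForm I M k) : DForm I M (k + 1) :=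
  fun x => ofChart I x (extDerivWithin (chartForm I x α) (range I) (extChartAt I x x))

/-- For `η` an alternating form and `A` an endomorphism, the alternating form
`(v₁, …, v_k) ↦ ∑ i, η(v₁, …, A vᵢ, …, v_k)`. -/
def derivationAction {V : Type*} [NormedAddCommGroup V] [NormedSpace ℝ V]
    (A : V →L[ℝ] V) (η : V [⋀^Fin k]→L[ℝ] ℝ) : V [⋀^Fin k]→L[ℝ] ℝ :=
  η.fderivCompContinuousLinearMap (ContinuousLinearMap.id ℝ V) A

theorem derivationAction_apply {V : Type*} [NormedAddCommGroup V] [NormedSpace ℝ V]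
    (A : V →L[ℝ] V) (η : V [⋀^Fin k]→L[ℝ] ℝ) (v : Fin k → V) :
    derivationAction A η v = ∑ i, η (Function.update v i (A (v i))) := by
  rw [derivationAction, ContinuousAlternatingMap.fderivCompContinuousLinearMap_apply]
  refine Finset.sum_congr rfl fun i _ => congrArg η (funext fun j => ?_)
  by_cases h : j = i
  · subst h; simp
  · simp [h]

/-- The Lie derivative `L_w α`. In the chart around `x`, where `w` reads `W` and `α` reads `Ω`,
`(L_W Ω)(v₁, …, v_k) = (D_W Ω)(v₁, …, v_k) + ∑ i, Ω(v₁, …, DW(vᵢ), …, v_k)`; this is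
the derivative at time zero of the pullback of `α` under the flow of `w`. -/
def lieD (w : VField I M) (α : DForm I M k) : DForm I M k :=
  fun x => ofChart I x
    (fderivWithin ℝ (chartForm I x α) (range I) (extChartAt I x x)
        (chartField I x w (extChartAt I x x)) +
      derivationAction (fderivWithin ℝ (chartField I x w) (range I) (extChartAt I x x))
        (chartForm I x α (extChartAt I x x)))

end Calculus

/-! ### Multisymplectic notions -/

section Plectic

variable {E H : Type*} [NormedAddCommGroup E] [NormedSpace ℝ E] [TopologicalSpace H]
  (I : ModelWithCorners ℝ E H) {M : Type*} [TopologicalSpace M] [ChartedSpace H M]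
  [IsManifold I ∞ M] {n : ℕ}

/-- `σ` is a pre-`n`-plectic form: a smooth closed `(n + 1)`-form. -/
structure IsPrePlectic (σ : DForm I M (n + 1)) : Prop where
  smooth : IsSmoothForm I σ
  closed : extD I σ = 0

/-- `σ` is an `n`-plectic form: it is pre-`n`-plectic and `v ↦ ι_v σ_p` is injective on every
tangent space. -/
structure IsPlectic (σ : DForm I M (n + 1)) : Prop extends IsPrePlectic I σ where
  nondegenerate : ∀ p : M, Function.Injective
    (fun v : TangentSpace I p => insertVector v (σ p))

/-- `v` is a Hamiltonian vector field for the smooth form `α` (which is therefore a Hamiltonian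
form), with respect to `σ`: `dα = - ι_v σ`. Here `σ` has degree `n + 2` and `α` has degree `n`. -/
structure IsHamiltonianField (σ : DForm I M (n + 2)) (α : DForm I M n) (v : VField I M) :
    Prop where
  smooth_form : IsSmoothForm I α
  smooth_field : IsSmoothField I v
  eq : extD I α = - interior I v σ

end Plectic

/-! ### The geometry of `Λ^k T^*N` -/

section Canonical

variable {E H : Type*} [NormedAddCommGroup E] [NormedSpace ℝ E] [TopologicalSpace H]
  (I : ModelWithCorners ℝ E H) {N : Type*} [TopologicalSpace N] [ChartedSpace H N]
  [IsManifold I ∞ N] (k : ℕ)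

variable (N) in
/-- The projection `π : Λ^k T^*N → N`. -/
def proj : FormBundle I N k → N := fun p => p.proj

variable (N) in
/-- The canonical (tautological) `k`-form on `Λ^k T^*N`, whose value at `p` is
`(v₁, …, v_k) ↦ p(dπ v₁, …, dπ v_k)`. -/
def tautologicalForm : DForm (formModel I k) (FormBundle I N k) k :=
  fun p => p.snd.compContinuousLinearMap (mfderiv (formModel I k) I (proj I N k) p)

variable (N) in
/-- The form `θ`; the canonical `k`-form is `-θ`. -/
def theta : DForm (formModel I k) (FormBundle I N k) k := -tautologicalForm I N k

/-- The canonical lift `w^h` of the vector field `w` to `Λ^k T^*N`, i.e. the generator of the flow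
`(φ_t⁻¹)^*` that the flow `φ_t` of `w` induces on `Λ^k T^*N`. In the bundle chart around `p` that is
induced by the chart of `N` around `π p`, where `w` reads `W` and `p` has the coordinates
`(y, η)`, its components are `W(y)` along the base and `- ∑ i, η(…, DW(y) vᵢ, …)` along
the fibre. For `k = 1` this is the vector field
`∑ W^i ∂/∂q^i - ∑ p_j (∂W^j/∂q^i) ∂/∂p_i`. -/
def canonicalLift (w : VField I N) : VField (formModel I k) (FormBundle I N k) :=
  fun p =>
    let c := extChartAt (formModel I k) p
    let W : E → E := chartField I (proj I N k p) w
    mfderivWithin 𝓘(ℝ, E × (E [⋀^Fin k]→L[ℝ] ℝ)) (formModel I k) c.symm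
      (range (formModel I k)) (c p)
      ((W (c p).1, - derivationAction (fderivWithin ℝ W (range I) (c p).1) (c p).2) :
        E × (E [⋀^Fin k]→L[ℝ] ℝ))

variable {I k}

/-- The form `ω = dθ + π^* db` on `Λ^k T^*N`. -/
def magneticForm (b : DForm I N k) :
    DForm (formModel I k) (FormBundle I N k) (k + 1) :=
  extD (formModel I k) (theta I N k) + pullback (formModel I k) I (proj I N k) (extD I b)

/-- The form `H = - π^* a + ι_{w^h} (θ + π^* b)` on `Λ^{k+1} T^*N`, where `b` has degree `k + 1`
and `a` has degree `k`. -/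
def magneticHamiltonian (w : VField I N) (b : DForm I N (k + 1)) (a : DForm I N k) :
    DForm (formModel I (k + 1)) (FormBundle I N (k + 1)) k :=
  - pullback (formModel I (k + 1)) I (proj I N (k + 1)) a +
    interior (formModel I (k + 1)) (canonicalLift I (k + 1) w)
      (theta I N (k + 1) + pullback (formModel I (k + 1)) I (proj I N (k + 1)) b)

end Canonical

end Multisymplectic

end

open Multisymplectic

/-!
Both parts rest on `ω = d(θ + π^* b)`. In particular `ω` is closed, and Cartan's formula gives
`dH + ι_{w^h} ω = -π^* da + L_{w^h} (θ + π^* b)`. The canonical lift preserves the tautological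
form and projects to `w`, so the Lie derivative on the right is `π^* L_w b = π^* da` and the sum
vanishes.

For nondegeneracy, `π^* db` is killed by vertical vectors, while contracting `dθ` with a vertical
vector `ζ`, which is itself a `k`-form on the base, yields `-π^* ζ`. Pairing a vector with all
vertical ones therefore detects its base component, provided `k ≤ dim N`, and contracting the
remaining vertical vector detects the fibre component.
-/

namespace Multisymplectic

open ContinuousAlternatingMap Filter Topology

section AlternatingForms

variable {V V' : Type*} [NormedAddCommGroup V] [NormedSpace ℝ V] [NormedAddCommGroup V']
  [NormedSpace ℝ V'] {k : ℕ}

theorem fderivCompContinuousLinearMap_comp_right (η : V' [⋀^Fin k]→L[ℝ] ℝ) (A : V →L[ℝ] V')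
    (C : V →L[ℝ] V) :
    η.fderivCompContinuousLinearMap A (A ∘L C) =
      derivationAction C (η.compContinuousLinearMap A) := by
  ext v
  rw [fderivCompContinuousLinearMap_apply, derivationAction_apply]
  refine Finset.sum_congr rfl fun i _ => congrArg η (funext fun j => ?_)
  obtain rfl | hj := eq_or_ne j i <;> simp [*]

theorem fderivCompContinuousLinearMap_comp_left (η : V' [⋀^Fin k]→L[ℝ] ℝ) (A : V →L[ℝ] V')
    (B : V' →L[ℝ] V') :
    η.fderivCompContinuousLinearMap A (B ∘L A) =
      (derivationAction B η).compContinuousLinearMap A := by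
  ext v
  rw [fderivCompContinuousLinearMap_apply, compContinuousLinearMap_apply, derivationAction_apply]
  refine Finset.sum_congr rfl fun i _ => congrArg η (funext fun j => ?_)
  obtain rfl | hj := eq_or_ne j i <;> simp [*]

theorem derivationAction_compContinuousLinearMap {A : V →L[ℝ] V'} {B : V' →L[ℝ] V'}
    {C : V →L[ℝ] V} (h : A ∘L C = B ∘L A) (η : V' [⋀^Fin k]→L[ℝ] ℝ) :
    derivationAction C (η.compContinuousLinearMap A) =
      (derivationAction B η).compContinuousLinearMap A := by
  rw [← fderivCompContinuousLinearMap_comp_right, h, fderivCompContinuousLinearMap_comp_left]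

theorem derivationAction_add (A : V →L[ℝ] V) (η ζ : V [⋀^Fin k]→L[ℝ] ℝ) :
    derivationAction A (η + ζ) = derivationAction A η + derivationAction A ζ :=
  DFunLike.congr_fun (map_add (fderivCompContinuousLinearMapCLM ℝ (.id ℝ V)) η ζ) A

theorem derivationAction_neg (A : V →L[ℝ] V) (η : V [⋀^Fin k]→L[ℝ] ℝ) :
    derivationAction A (-η) = -derivationAction A η :=
  DFunLike.congr_fun (map_neg (fderivCompContinuousLinearMapCLM ℝ (.id ℝ V)) η) A

theorem derivationAction_eq_alternatizeUncurryFin (A : V →L[ℝ] V) (η : V [⋀^Fin (k + 1)]→L[ℝ] ℝ) :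
    derivationAction A η = alternatizeUncurryFin (η.curryLeft ∘L A) := by
  rw [derivationAction, fderivCompContinuousLinearMap_eq_alternatizeUncurryFin]
  rfl

variable (V k) in
/-- `ContinuousAlternatingMap.curryLeft` as a continuous linear map, to be differentiated and
composed with other continuous linear maps. -/
noncomputable def curryLeftCLM : (V [⋀^Fin (k + 1)]→L[ℝ] ℝ) →L[ℝ] V →L[ℝ] V [⋀^Fin k]→L[ℝ] ℝ :=
  curryLeftLI.toContinuousLinearMap

theorem curryLeftCLM_apply (η : V [⋀^Fin (k + 1)]→L[ℝ] ℝ) : curryLeftCLM V k η = η.curryLeft :=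
  rfl

/-- `L` plays the role of the derivative of a `(k + 1)`-form and `x` that of a constant vector
field, so this is Cartan's formula for constant fields. -/
theorem alternatizeUncurryFin_curryLeft_add (L : V →L[ℝ] V [⋀^Fin (k + 1)]→L[ℝ] ℝ) (x : V) :
    alternatizeUncurryFin ((curryLeftCLM V k).flip x ∘L L) +
      (alternatizeUncurryFin L).curryLeft x = L x := by
  ext v
  have removeNth_succ (i : Fin (k + 1)) :
      i.succ.removeNth (Matrix.vecCons x v) = Matrix.vecCons x (i.removeNth v) := by
    funext j
    cases j using Fin.cases <;> simp [Fin.removeNth]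
  have removeNth_zero : Fin.removeNth 0 (Matrix.vecCons x v) = v := by
    funext j
    simp [Fin.removeNth]
  rw [ContinuousAlternatingMap.add_apply, curryLeft_apply_apply, alternatizeUncurryFin_apply,
    alternatizeUncurryFin_apply, Fin.sum_univ_succ (n := k + 1)]
  simp [removeNth_succ, removeNth_zero, pow_succ, curryLeftCLM_apply]

theorem curryLeft_alternatizeUncurryFin_of_curryLeft_eq_zero
    {L : V →L[ℝ] V [⋀^Fin (k + 1)]→L[ℝ] ℝ} {x : V} (h : ∀ y, (L y).curryLeft x = 0) :
    (alternatizeUncurryFin L).curryLeft x = L x := by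
  have contraction_eq_zero : (curryLeftCLM V k).flip x ∘L L = 0 := ContinuousLinearMap.ext h
  have alternatizeUncurryFin_zero : alternatizeUncurryFin (0 : V →L[ℝ] V [⋀^Fin k]→L[ℝ] ℝ) = 0 :=
    map_zero (alternatizeUncurryFinCLM ℝ V ℝ)
  have cartan := alternatizeUncurryFin_curryLeft_add L x
  rwa [contraction_eq_zero, alternatizeUncurryFin_zero, zero_add] at cartan

theorem curryLeft_curryLeft_comm (σ : V [⋀^Fin (k + 2)]→L[ℝ] ℝ) (x y : V) :
    (σ.curryLeft x).curryLeft y = -(σ.curryLeft y).curryLeft x := by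
  have h := curryLeft_same σ (x + y)
  simp only [map_add, curryLeft_add, _root_.add_apply, curryLeft_same, zero_add, add_zero] at h
  exact eq_neg_of_add_eq_zero_right h

end AlternatingForms

section Insertion

variable {V V' : Type*} [AddCommGroup V] [Module ℝ V] [TopologicalSpace V] [AddCommGroup V']
  [Module ℝ V'] [TopologicalSpace V'] {k : ℕ} {A : V →L[ℝ] V'}

theorem injective_compContinuousLinearMap (hA : Function.Surjective A) :
    Function.Injective fun η : V' [⋀^Fin k]→L[ℝ] ℝ => η.compContinuousLinearMap A := by
  intro η ζ h
  ext v
  obtain ⟨u, rfl⟩ := hA.comp_left v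
  exact DFunLike.congr_fun h u

theorem insertVector_compContinuousLinearMap (η : V' [⋀^Fin (k + 1)]→L[ℝ] ℝ) (A : V →L[ℝ] V')
    (v : V) :
    insertVector v (η.compContinuousLinearMap A) =
      (insertVector (A v) η).compContinuousLinearMap A := by
  ext u
  exact congrArg η (Fin.comp_cons A v u)

theorem injective_insertVector_compContinuousLinearMap (hA : Function.Bijective A)
    {η : V' [⋀^Fin (k + 1)]→L[ℝ] ℝ} (hη : Function.Injective fun v => insertVector v η) :
    Function.Injective fun v => insertVector v (η.compContinuousLinearMap A) := by
  simp only [insertVector_compContinuousLinearMap]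
  exact (injective_compContinuousLinearMap hA.surjective).comp (hη.comp hA.injective)

end Insertion

section Nondegeneracy

variable {V : Type*} [NormedAddCommGroup V] [NormedSpace ℝ V] {k : ℕ}

theorem exists_linearIndependent_zero_eq {x : V} (hx : x ≠ 0) :
    ∀ {k : ℕ}, ((k + 1 : ℕ) : Cardinal) ≤ Module.rank ℝ V →
      ∃ u : Fin (k + 1) → V, LinearIndependent ℝ u ∧ u 0 = x
  | 0, _ => ⟨fun _ => x, LinearIndependent.of_subsingleton (ι := Fin 1) 0 hx, rfl⟩
  | k + 1, hk => by
    have lt_rank : ((k + 1 : ℕ) : Cardinal) < Module.rank ℝ V :=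
      (Nat.cast_lt.2 (Nat.lt_succ_self _)).trans_le hk
    obtain ⟨u, hu, rfl⟩ := exists_linearIndependent_zero_eq hx lt_rank.le
    obtain ⟨y, hy⟩ := exists_linearIndependent_snoc_of_lt_rank hu lt_rank
    exact ⟨_, hy, Fin.snoc_castSucc (α := fun _ => V) y u 0⟩

theorem exists_form_apply_ne_zero {u : Fin k → V} (hu : LinearIndependent ℝ u) :
    ∃ ζ : V [⋀^Fin k]→L[ℝ] ℝ, ζ u ≠ 0 := by
  have surjective_restrict := (SeparatingDual.dualMap_surjective_iff (R := ℝ)).2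
    hu.fintypeLinearCombination_injective
  choose φ hφ using fun i => surjective_restrict (LinearMap.proj i)
  have dual_apply (i j : Fin k) : φ i (u j) = (1 : Matrix (Fin k) (Fin k) ℝ) j i := by
    simpa [Fintype.linearCombination_apply_single, Pi.single_apply, Matrix.one_apply, eq_comm]
      using LinearMap.congr_fun (hφ i) (Pi.single j 1)
  let det : (Fin k → ℝ) [⋀^Fin k]→L[ℝ] ℝ :=
    { Matrix.detRowAlternating with cont := continuous_id.matrix_det }
  refine ⟨det.compContinuousLinearMap (ContinuousLinearMap.pi φ), ?_⟩
  have det_apply : det.compContinuousLinearMap (ContinuousLinearMap.pi φ) u =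
      Matrix.det fun j i => φ i (u j) := rfl
  simp only [det_apply, dual_apply]
  exact Matrix.det_one.trans_ne one_ne_zero

theorem exists_curryLeft_ne_zero {x : V} (hx : x ≠ 0)
    (hk : ((k + 1 : ℕ) : Cardinal) ≤ Module.rank ℝ V) :
    ∃ ζ : V [⋀^Fin (k + 1)]→L[ℝ] ℝ, ζ.curryLeft x ≠ 0 := by
  obtain ⟨u, hu, rfl⟩ := exists_linearIndependent_zero_eq hx hk
  obtain ⟨ζ, hζ⟩ := exists_form_apply_ne_zero hu
  refine ⟨ζ, fun h => hζ ?_⟩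
  have eq_vecCons : u = Matrix.vecCons (u 0) (Fin.tail u) := (Fin.cons_self_tail u).symm
  rw [eq_vecCons, ← curryLeft_apply_apply, h]
  rfl

end Nondegeneracy

section Smoothness

variable {U V W : Type*} [NormedAddCommGroup U] [NormedSpace ℝ U] [NormedAddCommGroup V]
  [NormedSpace ℝ V] [NormedAddCommGroup W] [NormedSpace ℝ W] {k : ℕ} {n : WithTop ℕ∞} {x : U}

theorem contDiffAt_compContinuousLinearMap {α : U → W [⋀^Fin k]→L[ℝ] ℝ} {A : U → V →L[ℝ] W}
    (hα : ContDiffAt ℝ n α x) (hA : ContDiffAt ℝ n A x) :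
    ContDiffAt ℝ n (fun y => (α y).compContinuousLinearMap (A y)) x :=
  (contDiff_compContinuousLinearMapCLM.contDiffAt.comp x hA).clm_apply hα

theorem contDiffAt_curryLeft {α : U → V [⋀^Fin (k + 1)]→L[ℝ] ℝ} {X : U → V}
    (hα : ContDiffAt ℝ n α x) (hX : ContDiffAt ℝ n X x) :
    ContDiffAt ℝ n (fun y => (α y).curryLeft (X y)) x :=
  ContDiffAt.clm_apply (f := fun y => (α y).curryLeft)
    (ContDiffAt.comp x (g := curryLeftCLM V k) (ContinuousLinearMap.contDiff _).contDiffAt hα) hX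

theorem contDiffAt_derivationAction {A : U → V →L[ℝ] V} {α : U → V [⋀^Fin k]→L[ℝ] ℝ}
    (hA : ContDiffAt ℝ n A x) (hα : ContDiffAt ℝ n α x) :
    ContDiffAt ℝ n (fun y => derivationAction (A y) (α y)) x :=
  ContDiffAt.clm_apply (f := fun y => (α y).fderivCompContinuousLinearMap (.id ℝ V))
    (ContDiffAt.comp x (g := fderivCompContinuousLinearMapCLM ℝ (.id ℝ V))
      (ContinuousLinearMap.contDiff _).contDiffAt hα) hA

theorem contDiffAt_extDeriv {α : U → U [⋀^Fin k]→L[ℝ] ℝ} (hα : ContDiffAt ℝ ∞ α x) :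
    ContDiffAt ℝ ∞ (extDeriv α) x :=
  (alternatizeUncurryFinCLM ℝ U ℝ).contDiff.contDiffAt.comp x (hα.fderiv_right (by simp))

theorem minSmoothness_two_le_infty : minSmoothness ℝ 2 ≤ ∞ := by
  simpa using WithTop.coe_le_coe.2 (le_top : (2 : ℕ∞) ≤ ⊤)

end Smoothness

section LieDerivative

variable {V V' : Type*} [NormedAddCommGroup V] [NormedSpace ℝ V] [NormedAddCommGroup V']
  [NormedSpace ℝ V'] {k : ℕ} {x : V}

/-- The Lie derivative of the form `α` along the vector field `X`, on a normed space. -/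
noncomputable def lieDeriv (X : V → V) (α : V → V [⋀^Fin k]→L[ℝ] ℝ) (x : V) : V [⋀^Fin k]→L[ℝ] ℝ :=
  fderiv ℝ α x (X x) + derivationAction (fderiv ℝ X x) (α x)

theorem extDeriv_curryLeft_add_curryLeft_extDeriv {X : V → V} {α : V → V [⋀^Fin (k + 1)]→L[ℝ] ℝ}
    (hX : DifferentiableAt ℝ X x) (hα : DifferentiableAt ℝ α x) :
    extDeriv (fun y => (α y).curryLeft (X y)) x + (extDeriv α x).curryLeft (X x) =
      lieDeriv X α x := by
  have hasFDerivAt_curryLeft :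
      HasFDerivAt (fun y => (α y).curryLeft) (curryLeftCLM V k ∘L fderiv ℝ α x) x :=
    HasFDerivAt.comp x (g := curryLeftCLM V k) (ContinuousLinearMap.hasFDerivAt _) hα.hasFDerivAt
  have hasFDerivAt_contraction : HasFDerivAt (fun y => (α y).curryLeft (X y))
      ((α x).curryLeft ∘L fderiv ℝ X x + (curryLeftCLM V k).flip (X x) ∘L fderiv ℝ α x) x :=
    hasFDerivAt_curryLeft.clm_apply hX.hasFDerivAt
  rw [extDeriv, hasFDerivAt_contraction.fderiv, alternatizeUncurryFin_add, lieDeriv,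
    derivationAction_eq_alternatizeUncurryFin,
    ← alternatizeUncurryFin_curryLeft_add (fderiv ℝ α x) (X x), extDeriv]
  abel

theorem extDeriv_neg (α : V → V [⋀^Fin k]→L[ℝ] ℝ) : extDeriv (-α) x = -extDeriv α x := by
  rw [extDeriv, fderiv_neg, extDeriv]
  exact map_neg (alternatizeUncurryFinCLM ℝ V ℝ) (fderiv ℝ α x)

theorem lieDeriv_add (X : V → V) {α β : V → V [⋀^Fin k]→L[ℝ] ℝ} (hα : DifferentiableAt ℝ α x)
    (hβ : DifferentiableAt ℝ β x) :
    lieDeriv X (α + β) x = lieDeriv X α x + lieDeriv X β x := by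
  simp only [lieDeriv, fderiv_add hα hβ, Pi.add_apply, derivationAction_add,
    _root_.add_apply]
  abel

theorem lieDeriv_neg (X : V → V) (α : V → V [⋀^Fin k]→L[ℝ] ℝ) :
    lieDeriv X (-α) x = -lieDeriv X α x := by
  simp only [lieDeriv, fderiv_neg, Pi.neg_apply, derivationAction_neg,
    _root_.neg_apply, neg_add]

theorem lieDeriv_congr {X Y : V → V} {α β : V → V [⋀^Fin k]→L[ℝ] ℝ} (hX : X =ᶠ[𝓝 x] Y)
    (hα : α =ᶠ[𝓝 x] β) : lieDeriv X α x = lieDeriv Y β x := by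
  rw [lieDeriv, lieDeriv, hX.fderiv_eq, hα.fderiv_eq, hX.self_of_nhds, hα.self_of_nhds]

theorem comp_fderiv_of_eventually_comp_eq {p : V →L[ℝ] V'} {X : V → V} {X' : V' → V'}
    (hX : DifferentiableAt ℝ X x) (hX' : DifferentiableAt ℝ X' (p x))
    (h : ∀ᶠ y in 𝓝 x, p (X y) = X' (p y)) :
    p ∘L fderiv ℝ X x = fderiv ℝ X' (p x) ∘L p :=
  (p.hasFDerivAt.comp x hX.hasFDerivAt).unique
    ((hX'.hasFDerivAt.comp x p.hasFDerivAt).congr_of_eventuallyEq h)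

theorem lieDeriv_compContinuousLinearMap {p : V →L[ℝ] V'} {X : V → V} {X' : V' → V'}
    {β : V' → V' [⋀^Fin k]→L[ℝ] ℝ} (hX : DifferentiableAt ℝ X x)
    (hX' : DifferentiableAt ℝ X' (p x)) (hβ : DifferentiableAt ℝ β (p x))
    (h : ∀ᶠ y in 𝓝 x, p (X y) = X' (p y)) :
    lieDeriv X (fun y => (β (p y)).compContinuousLinearMap p) x =
      (lieDeriv X' β (p x)).compContinuousLinearMap p := by
  have hasFDerivAt_comp : HasFDerivAt (fun y => (β (p y)).compContinuousLinearMap p)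
      (compContinuousLinearMapCLM p ∘L fderiv ℝ β (p x) ∘L p) x :=
    (compContinuousLinearMapCLM p : (V' [⋀^Fin k]→L[ℝ] ℝ) →L[ℝ] _).hasFDerivAt.comp x
      (hβ.hasFDerivAt.comp x p.hasFDerivAt)
  rw [lieDeriv, hasFDerivAt_comp.fderiv,
    derivationAction_compContinuousLinearMap (comp_fderiv_of_eventually_comp_eq hX hX' h), lieDeriv,
    ← h.self_of_nhds]
  rfl

end LieDerivative

section ModelPhaseSpace

variable {E : Type*} [NormedAddCommGroup E] [NormedSpace ℝ E] {k : ℕ}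
  {z : E × (E [⋀^Fin k]→L[ℝ] ℝ)} {W : E → E}

variable (E k) in
/-- The tautological `k`-form on the phase space `E × Λ^k E^*` of a normed space; it depends
linearly on the point, and as a continuous linear map it is its own derivative. -/
noncomputable def modelTautologicalForm : (E × (E [⋀^Fin k]→L[ℝ] ℝ)) →L[ℝ]
    (E × (E [⋀^Fin k]→L[ℝ] ℝ)) [⋀^Fin k]→L[ℝ] ℝ :=
  compContinuousLinearMapCLM (.fst ℝ E (E [⋀^Fin k]→L[ℝ] ℝ)) ∘L .snd ℝ E (E [⋀^Fin k]→L[ℝ] ℝ)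

theorem modelTautologicalForm_apply (z : E × (E [⋀^Fin k]→L[ℝ] ℝ)) :
    modelTautologicalForm E k z = z.2.compContinuousLinearMap (.fst ℝ E (E [⋀^Fin k]→L[ℝ] ℝ)) :=
  rfl

theorem curryLeft_compContinuousLinearMap_fst {F : Type*} [NormedAddCommGroup F] [NormedSpace ℝ F]
    (η : E [⋀^Fin (k + 1)]→L[ℝ] ℝ) (ζ : F) :
    (η.compContinuousLinearMap (.fst ℝ E F)).curryLeft (0, ζ) = 0 := by
  ext v
  exact η.map_coord_zero 0 rfl

theorem curryLeft_extDeriv_modelTautologicalForm (z : E × (E [⋀^Fin (k + 1)]→L[ℝ] ℝ))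
    (ζ : E [⋀^Fin (k + 1)]→L[ℝ] ℝ) :
    (extDeriv (modelTautologicalForm E (k + 1)) z).curryLeft (0, ζ) =
      ζ.compContinuousLinearMap (.fst ℝ E (E [⋀^Fin (k + 1)]→L[ℝ] ℝ)) := by
  have vertical_eq_zero (z : E × (E [⋀^Fin (k + 1)]→L[ℝ] ℝ)) :
      (modelTautologicalForm E (k + 1) z).curryLeft (0, ζ) = 0 :=
    curryLeft_compContinuousLinearMap_fst z.2 ζ
  rw [extDeriv, ContinuousLinearMap.fderiv,
    curryLeft_alternatizeUncurryFin_of_curryLeft_eq_zero vertical_eq_zero,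
    modelTautologicalForm_apply]

theorem injective_curryLeft_of_vertical (hk : ((k + 1 : ℕ) : Cardinal) ≤ Module.rank ℝ E)
    {σ : (E × (E [⋀^Fin (k + 1)]→L[ℝ] ℝ)) [⋀^Fin (k + 2)]→L[ℝ] ℝ}
    (hσ : ∀ ζ : E [⋀^Fin (k + 1)]→L[ℝ] ℝ, σ.curryLeft (0, ζ) =
      -ζ.compContinuousLinearMap (.fst ℝ E (E [⋀^Fin (k + 1)]→L[ℝ] ℝ))) :
    Function.Injective σ.curryLeft := by
  rw [injective_iff_map_eq_zero]
  rintro ⟨x, η⟩ h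
  obtain rfl : x = 0 := by
    by_contra hx
    obtain ⟨ζ, hζ⟩ := exists_curryLeft_ne_zero hx hk
    have hxζ := curryLeft_curryLeft_comm σ (0, ζ) (x, η)
    rw [h, hσ] at hxζ
    refine hζ (injective_compContinuousLinearMap
      (A := ContinuousLinearMap.fst ℝ E (E [⋀^Fin (k + 1)]→L[ℝ] ℝ)) Prod.fst_surjective ?_)
    ext v
    have comp_vecCons : Prod.fst ∘ Matrix.vecCons (x, η) v = Matrix.vecCons x (Prod.fst ∘ v) :=
      Fin.comp_cons Prod.fst (x, η) v
    simpa [comp_vecCons] using DFunLike.congr_fun hxζ v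
  rw [hσ, neg_eq_zero] at h
  have hη : η = 0 := injective_compContinuousLinearMap
    (A := ContinuousLinearMap.fst ℝ E (E [⋀^Fin (k + 1)]→L[ℝ] ℝ)) Prod.fst_surjective h
  rw [hη, Prod.mk_zero_zero]

/-- The canonical lift of the vector field `W` on `E` to the phase space `E × Λ^k E^*`. -/
noncomputable def modelLift (W : E → E) (z : E × (E [⋀^Fin k]→L[ℝ] ℝ)) : E × (E [⋀^Fin k]→L[ℝ] ℝ) :=
  (W z.1, -derivationAction (fderiv ℝ W z.1) z.2)

theorem contDiffAt_modelLift (hW : ContDiffAt ℝ ∞ W z.1) : ContDiffAt ℝ ∞ (modelLift W) z := by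
  have contDiffAt_fderiv : ContDiffAt ℝ ∞ (fun z : E × (E [⋀^Fin k]→L[ℝ] ℝ) => fderiv ℝ W z.1) z :=
    (hW.fderiv_right (m := ∞) (by simp)).comp z contDiffAt_fst
  exact (hW.comp z contDiffAt_fst).prodMk
    (contDiffAt_derivationAction contDiffAt_fderiv contDiffAt_snd).neg

theorem fst_comp_fderiv_modelLift (hW : ContDiffAt ℝ ∞ W z.1) :
    .fst ℝ E (E [⋀^Fin k]→L[ℝ] ℝ) ∘L fderiv ℝ (modelLift W) z =
      fderiv ℝ W z.1 ∘L .fst ℝ E (E [⋀^Fin k]→L[ℝ] ℝ) :=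
  comp_fderiv_of_eventually_comp_eq ((contDiffAt_modelLift hW).differentiableAt (by simp))
    (hW.differentiableAt (by simp)) (.of_forall fun _ => rfl)

theorem lieDeriv_modelLift_modelTautologicalForm (hW : ContDiffAt ℝ ∞ W z.1) :
    lieDeriv (modelLift W) (modelTautologicalForm E k) z = 0 := by
  rw [lieDeriv, ContinuousLinearMap.fderiv, modelTautologicalForm_apply,
    modelTautologicalForm_apply,
    derivationAction_compContinuousLinearMap (fst_comp_fderiv_modelLift hW), modelLift]
  ext v
  simp

theorem lieDeriv_modelLift_comp_fst {m : ℕ} {β : E → E [⋀^Fin m]→L[ℝ] ℝ}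
    (hW : ContDiffAt ℝ ∞ W z.1) (hβ : DifferentiableAt ℝ β z.1) :
    lieDeriv (modelLift W)
        (fun z => (β z.1).compContinuousLinearMap (.fst ℝ E (E [⋀^Fin k]→L[ℝ] ℝ))) z =
      (lieDeriv W β z.1).compContinuousLinearMap (.fst ℝ E (E [⋀^Fin k]→L[ℝ] ℝ)) :=
  lieDeriv_compContinuousLinearMap (p := .fst ℝ E (E [⋀^Fin k]→L[ℝ] ℝ))
    ((contDiffAt_modelLift hW).differentiableAt (by simp)) (hW.differentiableAt (by simp)) hβ
    (.of_forall fun _ => rfl)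

theorem fderiv_comp_fderiv_of_eventually_related {V V' : Type*} [NormedAddCommGroup V]
    [NormedSpace ℝ V] [NormedAddCommGroup V'] [NormedSpace ℝ V'] {ψ : V' → V} {X : V → V}
    {X' : V' → V'} {x : V'} (hψ : ContDiffAt ℝ ∞ ψ x) (hX : DifferentiableAt ℝ X (ψ x))
    (hX' : DifferentiableAt ℝ X' x) (h : ∀ᶠ y in 𝓝 x, X (ψ y) = fderiv ℝ ψ y (X' y)) :
    fderiv ℝ X (ψ x) ∘L fderiv ℝ ψ x =
      fderiv ℝ (fderiv ℝ ψ) x (X' x) + fderiv ℝ ψ x ∘L fderiv ℝ X' x := by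
  have hasFDerivAt_fderiv :=
    ((hψ.fderiv_right (m := ∞) (by simp)).differentiableAt (by simp)).hasFDerivAt
  have left := hX.hasFDerivAt.comp x (hψ.differentiableAt (by simp)).hasFDerivAt
  have right := (hasFDerivAt_fderiv.clm_apply hX'.hasFDerivAt).congr_of_eventuallyEq h
  rw [left.unique right]
  ext v
  simp [(hψ.isSymmSndFDerivAt minSmoothness_two_le_infty).eq v (X' x), add_comm]

/-- The second derivative of `ψ` that appears on differentiating the fibre coordinate is cancelled
by the one in the relation between `DW` and `DW'`. -/
theorem fderiv_apply_modelLift {φ ψ : E → E} {W' : E → E}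
    (hφ : ContDiffAt ℝ ∞ φ z.1) (hψ : ContDiffAt ℝ ∞ ψ (φ z.1))
    (hψφ : ψ (φ z.1) = z.1) (hφψ : φ ∘ ψ =ᶠ[𝓝 (φ z.1)] id)
    (hW : DifferentiableAt ℝ W z.1) (hW' : DifferentiableAt ℝ W' (φ z.1))
    (h : ∀ᶠ x in 𝓝 (φ z.1), W (ψ x) = fderiv ℝ ψ x (W' x)) :
    fderiv ℝ (fun z : E × (E [⋀^Fin k]→L[ℝ] ℝ) =>
        (φ z.1, z.2.compContinuousLinearMap (fderiv ℝ ψ (φ z.1)))) z (modelLift W z) =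
      modelLift W' (φ z.1, z.2.compContinuousLinearMap (fderiv ℝ ψ (φ z.1))) := by
  obtain ⟨y, η⟩ := z
  have hasFDerivAt_φ := (hφ.differentiableAt (by simp)).hasFDerivAt
  have hasFDerivAt_ψ := (hψ.differentiableAt (by simp)).hasFDerivAt
  have hasFDerivAt_fderiv :=
    ((hψ.fderiv_right (m := ∞) (by simp)).differentiableAt (by simp)).hasFDerivAt
  have fderiv_φ_comp : fderiv ℝ φ y ∘L fderiv ℝ ψ (φ y) = .id ℝ E :=
    ((HasFDerivAt.comp (φ y) (by rwa [hψφ]) hasFDerivAt_ψ).congr_of_eventuallyEq hφψ.symm).unique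
      (hasFDerivAt_id _)
  have fderiv_φ_apply : fderiv ℝ φ y (W y) = W' (φ y) := by
    rw [← congrArg W hψφ, h.self_of_nhds]
    exact DFunLike.congr_fun fderiv_φ_comp _
  have fderiv_W_comp : fderiv ℝ W y ∘L fderiv ℝ ψ (φ y) =
      fderiv ℝ (fderiv ℝ ψ) (φ y) (W' (φ y)) + fderiv ℝ ψ (φ y) ∘L fderiv ℝ W' (φ y) := by
    simpa only [hψφ] using fderiv_comp_fderiv_of_eventually_related hψ (hψφ.symm ▸ hW) hW' h
  have hasFDerivAt_base := hasFDerivAt_φ.comp (y, η) hasFDerivAt_fst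
  have hasFDerivAt_fibre :=
    (hasFDerivAt_snd (𝕜 := ℝ) (p := (y, η))).continuousAlternatingMapCompContinuousLinearMap
      (hasFDerivAt_fderiv.comp (y, η) hasFDerivAt_base)
  refine (DFunLike.congr_fun (hasFDerivAt_base.prodMk hasFDerivAt_fibre).fderiv _).trans
    (Prod.ext fderiv_φ_apply ?_)
  have fibre_cancel := fderivCompContinuousLinearMap_comp_left η (fderiv ℝ ψ (φ y)) (fderiv ℝ W y)
  rw [fderiv_W_comp] at fibre_cancel
  simp only [map_add, fderivCompContinuousLinearMap_comp_right] at fibre_cancel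
  have neg_comp : (-derivationAction (fderiv ℝ W y) η).compContinuousLinearMap (fderiv ℝ ψ (φ y)) =
    -(derivationAction (fderiv ℝ W y) η).compContinuousLinearMap (fderiv ℝ ψ (φ y)) := rfl
  simp [modelLift, neg_comp, fderiv_φ_apply, ← fibre_cancel]

end ModelPhaseSpace

section Pullback

variable {E H : Type*} [NormedAddCommGroup E] [NormedSpace ℝ E] [TopologicalSpace H]
  {I : ModelWithCorners ℝ E H} {M : Type*} [TopologicalSpace M] [ChartedSpace H M]
  {E' H' : Type*} [NormedAddCommGroup E'] [NormedSpace ℝ E'] [TopologicalSpace H']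
  {I' : ModelWithCorners ℝ E' H'} {M' : Type*} [TopologicalSpace M'] [ChartedSpace H' M']
  {E'' H'' : Type*} [NormedAddCommGroup E''] [NormedSpace ℝ E''] [TopologicalSpace H'']
  {I'' : ModelWithCorners ℝ E'' H''} {M'' : Type*} [TopologicalSpace M''] [ChartedSpace H'' M'']
  {k : ℕ}

theorem compContinuousLinearMap_congr (α : DForm I M k) {z z' : M} {A A' : E' →L[ℝ] E}
    (hz : z = z') (hA : A = A') :
    (show E [⋀^Fin k]→L[ℝ] ℝ from α z).compContinuousLinearMap A =
      (show E [⋀^Fin k]→L[ℝ] ℝ from α z').compContinuousLinearMap A' := by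
  subst hz hA
  rfl

theorem pullback_congr {f g : M → M'} {x : M} (h : f =ᶠ[𝓝 x] g) (α : DForm I' M' k) :
    pullback I I' f α x = pullback I I' g α x :=
  compContinuousLinearMap_congr (E' := E) α h.self_of_nhds h.mfderiv_eq

theorem pullback_comp_apply {g : M' → M''} {f : M → M'} {x : M}
    (hg : MDifferentiableAt I' I'' g (f x)) (hf : MDifferentiableAt I I' f x)
    (α : DForm I'' M'' k) :
    pullback I I'' (g ∘ f) α x = pullback I I' f (pullback I' I'' g α) x := by
  simp only [pullback]
  rw [mfderiv_comp x hg hf]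
  rfl

theorem pullback_id (α : DForm I M k) : pullback I I id α = α := by
  funext x
  simp only [pullback, mfderiv_id]
  rfl

theorem pullback_modelSpace (f : E → E') (α : DForm 𝓘(ℝ, E') E' k) (x : E) :
    pullback 𝓘(ℝ, E) 𝓘(ℝ, E') f α x =
      (show E' [⋀^Fin k]→L[ℝ] ℝ from α (f x)).compContinuousLinearMap (fderiv ℝ f x) := by
  rw [pullback, mfderiv_eq_fderiv]
  rfl

theorem chartForm_eq_pullback [I.Boundaryless] (x : M) (α : DForm I M k) :
    chartForm I x α = pullback 𝓘(ℝ, E) I (extChartAt I x).symm α := by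
  funext y
  rw [chartForm, pullback, I.range_eq_univ, mfderivWithin_univ]
  rfl

theorem chartForm_add (x : M) (α β : DForm I M k) :
    chartForm I x (α + β) = chartForm I x α + chartForm I x β :=
  rfl

theorem chartForm_neg (x : M) (α : DForm I M k) : chartForm I x (-α) = -chartForm I x α :=
  rfl

end Pullback

section Charts

variable {E H : Type*} [NormedAddCommGroup E] [NormedSpace ℝ E] [TopologicalSpace H]
  {I : ModelWithCorners ℝ E H} {M : Type*} [TopologicalSpace M] [ChartedSpace H M]
  [IsManifold I ∞ M] {x : M} {k : ℕ}

variable (I M) in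
theorem isManifold_one : IsManifold I 1 M :=
  .of_le (n := ∞) (by exact_mod_cast le_top)

theorem contMDiffAt_extChartAt_of_mem_source {z : M} (hz : z ∈ (extChartAt I x).source) :
    ContMDiffAt I 𝓘(ℝ, E) ∞ (extChartAt I x) z :=
  contMDiffAt_extChartAt' (by rwa [← extChartAt_source I])

theorem bijective_mfderiv_extChartAt (x : M) :
    Function.Bijective (mfderiv I 𝓘(ℝ, E) (extChartAt I x) x) :=
  have := isManifold_one I M
  (isInvertible_mfderiv_extChartAt (mem_extChartAt_source x)).bijective

theorem injective_ofChart (x : M) :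
    Function.Injective (ofChart I x : E [⋀^Fin k]→L[ℝ] ℝ → _) :=
  injective_compContinuousLinearMap (bijective_mfderiv_extChartAt x).surjective

theorem trivializationAt_snd_eq_chartForm {x z : M} (hz : z ∈ (extChartAt I x).source)
    (α : DForm I M k) :
    (trivializationAt (E [⋀^Fin k]→L[ℝ] ℝ)
      (fun x : M => TangentSpace I x [⋀^Fin k]→L[ℝ] ℝ) x ⟨z, α z⟩).2 =
      chartForm I x α (extChartAt I x z) := by
  have := isManifold_one I M
  have hz' : z ∈ (chartAt H x).source := by simpa using hz
  refine Eq.trans ?_ (compContinuousLinearMap_congr α ((extChartAt I x).left_inv hz).symm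
    (TangentBundle.symmL_trivializationAt (𝕜 := ℝ) hz'))
  rw [FiberBundle.trivializationAt_continuousAlternatingMap_apply]
  ext v
  simp only [inCoordinates, Trivial.fiberBundle_trivializationAt',
    Trivial.continuousLinearMapAt_trivialization, compContinuousLinearMap_apply,
    ContinuousLinearMap.compContinuousAlternatingMap_coe, ContinuousLinearMap.coe_id',
    Function.comp_apply, id_eq]
  rfl

variable [I.Boundaryless]

theorem contMDiffAt_extChartAt_symm {y : E} (hy : y ∈ (extChartAt I x).target) :
    ContMDiffAt 𝓘(ℝ, E) I ∞ (extChartAt I x).symm y :=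
  (contMDiffOn_extChartAt_symm x).contMDiffAt (extChartAt_target_mem_nhds' hy)

theorem ofChart_chartForm (x : M) (α : DForm I M k) :
    ofChart I x (chartForm I x α (extChartAt I x x)) = α x := by
  have symm_comp : (extChartAt I x).symm ∘ extChartAt I x =ᶠ[𝓝 x] id :=
    (extChartAt I x).leftInvOn.eqOn.eventuallyEq_of_mem (extChartAt_source_mem_nhds x)
  have pullback_eq := pullback_comp_apply (I := I) (I' := 𝓘(ℝ, E))
    ((contMDiffAt_extChartAt_symm (mem_extChartAt_target x)).mdifferentiableAt (by simp))
    ((contMDiffAt_extChartAt_of_mem_source (mem_extChartAt_source x)).mdifferentiableAt (by simp)) α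
  rw [pullback_congr symm_comp, pullback_id, ← chartForm_eq_pullback] at pullback_eq
  exact pullback_eq.symm

theorem chartForm_of_eq_ofChart {α : DForm I M k} {η : E [⋀^Fin k]→L[ℝ] ℝ}
    (h : α x = ofChart I x η) : chartForm I x α (extChartAt I x x) = η :=
  injective_ofChart x ((ofChart_chartForm x α).trans h)

theorem DForm.ext_chartForm {α β : DForm I M k}
    (h : ∀ x, chartForm I x α (extChartAt I x x) = chartForm I x β (extChartAt I x x)) :
    α = β := by
  funext x
  rw [← ofChart_chartForm x α, h, ofChart_chartForm]

theorem injective_insertVector_of_chartForm {α : DForm I M (k + 1)}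
    (h : Function.Injective (chartForm I x α (extChartAt I x x)).curryLeft) :
    Function.Injective fun v : TangentSpace I x => insertVector v (α x) := by
  rw [← ofChart_chartForm x α]
  exact injective_insertVector_compContinuousLinearMap (bijective_mfderiv_extChartAt x) h

end Charts

section Sections

variable {E H : Type*} [NormedAddCommGroup E] [NormedSpace ℝ E] [TopologicalSpace H]
  {I : ModelWithCorners ℝ E H} [I.Boundaryless] {M : Type*} [TopologicalSpace M]
  [ChartedSpace H M] [IsManifold I ∞ M] {F : Type*} [NormedAddCommGroup F] [NormedSpace ℝ F]
  {k : ℕ}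

theorem contMDiffOn_source_iff_contDiffAt {x : M} {s : M → F} {s' : E → F}
    (h : ∀ z ∈ (extChartAt I x).source, s z = s' (extChartAt I x z)) :
    ContMDiffOn I 𝓘(ℝ, F) ∞ s (extChartAt I x).source ↔
      ∀ y ∈ (extChartAt I x).target, ContDiffAt ℝ ∞ s' y := by
  constructor
  · intro hs y hy
    rw [← contMDiffAt_iff_contDiffAt]
    have hz := (extChartAt I x).map_target hy
    refine (((hs _ hz).contMDiffAt (extChartAt_source_mem_nhds' hz)).comp y
      (contMDiffAt_extChartAt_symm hy)).congr_of_eventuallyEq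
        (EqOn.eventuallyEq_of_mem (fun u hu => ?_) (extChartAt_target_mem_nhds' hy))
    rw [Function.comp_apply, h _ ((extChartAt I x).map_target hu), (extChartAt I x).right_inv hu]
  · intro hs z hz
    refine ContMDiffAt.contMDiffWithinAt (((contMDiffAt_iff_contDiffAt.2
      (hs _ ((extChartAt I x).map_source hz))).comp z
        (contMDiffAt_extChartAt_of_mem_source hz)).congr_of_eventuallyEq ?_)
    exact EqOn.eventuallyEq_of_mem h (extChartAt_source_mem_nhds' hz)

theorem contMDiff_section_iff {V : M → Type*} [TopologicalSpace (TotalSpace F V)]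
    [∀ x, TopologicalSpace (V x)] [∀ x, AddCommMonoid (V x)] [∀ x, Module ℝ (V x)]
    [FiberBundle F V] [VectorBundle ℝ F V] [ContMDiffVectorBundle ∞ F V I] {s : ∀ x, V x}
    {s' : M → E → F} (base : ∀ x, (extChartAt I x).source ⊆ (trivializationAt F V x).baseSet)
    (h : ∀ x, ∀ z ∈ (extChartAt I x).source,
      (trivializationAt F V x ⟨z, s z⟩).2 = s' x (extChartAt I x z)) :
    ContMDiff I (I.prod 𝓘(ℝ, F)) ∞ (fun x => TotalSpace.mk' F x (s x)) ↔
      ∀ x, ∀ y ∈ (extChartAt I x).target, ContDiffAt ℝ ∞ (s' x) y := by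
  have contMDiffOn_iff (x : M) := (trivializationAt F V x).contMDiffOn_section_iff (n := ∞)
    (IB := I) (s := s) (isOpen_extChartAt_source x) (base x)
  simp only [← contMDiffOn_source_iff_contDiffAt (h _), ← contMDiffOn_iff]
  exact ⟨fun hs x => hs.contMDiffOn,
    fun hs x => (hs x).contMDiffAt (extChartAt_source_mem_nhds x)⟩

theorem isSmoothForm_iff {α : DForm I M k} :
    IsSmoothForm I α ↔
      ∀ x, ∀ y ∈ (extChartAt I x).target, ContDiffAt ℝ ∞ (chartForm I x α) y :=
  have := isManifold_one I M
  contMDiff_section_iff (fun x z hz => by simpa using hz)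
    fun _ _ hz => trivializationAt_snd_eq_chartForm hz α

theorem IsSmoothForm.add {α β : DForm I M k} (hα : IsSmoothForm I α) (hβ : IsSmoothForm I β) :
    IsSmoothForm I (α + β) :=
  isSmoothForm_iff.2 fun x y hy => (isSmoothForm_iff.1 hα x y hy).add (isSmoothForm_iff.1 hβ x y hy)

theorem IsSmoothForm.neg {α : DForm I M k} (hα : IsSmoothForm I α) : IsSmoothForm I (-α) :=
  isSmoothForm_iff.2 fun x y hy => (isSmoothForm_iff.1 hα x y hy).neg

end Sections

section ChartExpressions

variable {E H : Type*} [NormedAddCommGroup E] [NormedSpace ℝ E] [TopologicalSpace H]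
  {I : ModelWithCorners ℝ E H} [I.Boundaryless]
  {M : Type*} [TopologicalSpace M] [ChartedSpace H M] [IsManifold I ∞ M]
  {E' H' : Type*} [NormedAddCommGroup E'] [NormedSpace ℝ E'] [TopologicalSpace H']
  {I' : ModelWithCorners ℝ E' H'}
  {M' : Type*} [TopologicalSpace M'] [ChartedSpace H' M']
  {f : M → M'} {x : M} {x' : M'} {y : E} {k : ℕ}

theorem eventually_mem_source_inCharts (hy : y ∈ (extChartAt I x).target)
    (hf : ContinuousAt f ((extChartAt I x).symm y))
    (hfy : f ((extChartAt I x).symm y) ∈ (extChartAt I' x').source) :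
    ∀ᶠ u in 𝓝 y, u ∈ (extChartAt I x).target ∧
      f ((extChartAt I x).symm u) ∈ (extChartAt I' x').source :=
  (eventually_mem_set.2 (extChartAt_target_mem_nhds' hy)).and
    ((hf.comp (contMDiffAt_extChartAt_symm hy).continuousAt).eventually_mem
      (extChartAt_source_mem_nhds' hfy))

variable [IsManifold I' ∞ M']

theorem contDiffAt_inCharts (hy : y ∈ (extChartAt I x).target)
    (hf : ContMDiffAt I I' ∞ f ((extChartAt I x).symm y))
    (hfy : f ((extChartAt I x).symm y) ∈ (extChartAt I' x').source) :
    ContDiffAt ℝ ∞ (extChartAt I' x' ∘ f ∘ (extChartAt I x).symm) y :=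
  contMDiffAt_iff_contDiffAt.1 ((contMDiffAt_extChartAt_of_mem_source hfy).comp y
    (hf.comp y (contMDiffAt_extChartAt_symm hy)))

variable [I'.Boundaryless]

theorem chartForm_pullback (hy : y ∈ (extChartAt I x).target)
    (hf : ContMDiffAt I I' ∞ f ((extChartAt I x).symm y))
    (hfy : f ((extChartAt I x).symm y) ∈ (extChartAt I' x').source) (α : DForm I' M' k) :
    chartForm I x (pullback I I' f α) y =
      (chartForm I' x' α (extChartAt I' x' (f ((extChartAt I x).symm y)))).compContinuousLinearMap
        (fderiv ℝ (extChartAt I' x' ∘ f ∘ (extChartAt I x).symm) y) := by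
  have comp_symm_eq : f ∘ (extChartAt I x).symm =ᶠ[𝓝 y]
      (extChartAt I' x').symm ∘ (extChartAt I' x' ∘ f ∘ (extChartAt I x).symm) := by
    filter_upwards [eventually_mem_source_inCharts hy hf.continuousAt hfy] with u hu
    exact ((extChartAt I' x').left_inv hu.2).symm
  have symm_differentiable := (contMDiffAt_extChartAt_symm hy).mdifferentiableAt (by simp)
  have symm_differentiable' :=
    (contMDiffAt_extChartAt_symm ((extChartAt I' x').map_source hfy)).mdifferentiableAt (by simp)
  have inCharts_differentiable :=
    ((contDiffAt_inCharts hy hf hfy).differentiableAt (by simp)).mdifferentiableAt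
  rw [chartForm_eq_pullback, chartForm_eq_pullback,
    ← pullback_comp_apply (hf.mdifferentiableAt (by simp)) symm_differentiable,
    pullback_congr comp_symm_eq]
  exact (pullback_comp_apply (f := extChartAt I' x' ∘ f ∘ (extChartAt I x).symm)
    symm_differentiable' inCharts_differentiable α).trans (pullback_modelSpace _ _ _)

theorem extDeriv_chartForm_pullback (hy : y ∈ (extChartAt I x).target) (hf : ContMDiff I I' ∞ f)
    (hfy : f ((extChartAt I x).symm y) ∈ (extChartAt I' x').source) {α : DForm I' M' k}
    (hα : IsSmoothForm I' α) :
    extDeriv (chartForm I x (pullback I I' f α)) y =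
      (extDeriv (chartForm I' x' α)
        (extChartAt I' x' (f ((extChartAt I x).symm y)))).compContinuousLinearMap
        (fderiv ℝ (extChartAt I' x' ∘ f ∘ (extChartAt I x).symm) y) := by
  have chartForm_eq : chartForm I x (pullback I I' f α) =ᶠ[𝓝 y] fun u =>
      (chartForm I' x' α
        ((extChartAt I' x' ∘ f ∘ (extChartAt I x).symm) u)).compContinuousLinearMap
          (fderiv ℝ (extChartAt I' x' ∘ f ∘ (extChartAt I x).symm) u) := by
    filter_upwards [eventually_mem_source_inCharts hy hf.continuous.continuousAt hfy] with u hu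
    exact chartForm_pullback hu.1 hf.contMDiffAt hu.2 α
  rw [chartForm_eq.extDeriv_eq]
  exact extDeriv_pullback
    ((isSmoothForm_iff.1 hα x' _ ((extChartAt I' x').map_source hfy)).differentiableAt (by simp))
    (contDiffAt_inCharts hy hf.contMDiffAt hfy) minSmoothness_two_le_infty

theorem IsSmoothForm.pullback (hf : ContMDiff I I' ∞ f) {α : DForm I' M' k}
    (hα : IsSmoothForm I' α) : IsSmoothForm I (pullback I I' f α) := by
  refine isSmoothForm_iff.2 fun x y hy => ?_
  have hfy := mem_extChartAt_source (I := I') (f ((extChartAt I x).symm y))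
  have inCharts_smooth := contDiffAt_inCharts hy hf.contMDiffAt hfy
  refine (contDiffAt_compContinuousLinearMap
    (ContDiffAt.comp (f := extChartAt I' _ ∘ f ∘ (extChartAt I x).symm) y
      (isSmoothForm_iff.1 hα _ _ ((extChartAt I' _).map_source hfy)) inCharts_smooth)
    (inCharts_smooth.fderiv_right (by simp))).congr_of_eventuallyEq ?_
  filter_upwards [eventually_mem_source_inCharts hy hf.continuous.continuousAt hfy] with u hu
  exact chartForm_pullback hu.1 hf.contMDiffAt hu.2 α

end ChartExpressions

section ExteriorDerivative

variable {E H : Type*} [NormedAddCommGroup E] [NormedSpace ℝ E] [TopologicalSpace H]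
  {I : ModelWithCorners ℝ E H} [I.Boundaryless]
  {M : Type*} [TopologicalSpace M] [ChartedSpace H M] [IsManifold I ∞ M]
  {E' H' : Type*} [NormedAddCommGroup E'] [NormedSpace ℝ E'] [TopologicalSpace H']
  {I' : ModelWithCorners ℝ E' H'} [I'.Boundaryless]
  {M' : Type*} [TopologicalSpace M'] [ChartedSpace H' M'] [IsManifold I' ∞ M']
  {x : M} {y : E} {k : ℕ}

theorem chartForm_change {x' : M} (hy : y ∈ (extChartAt I x).target)
    (hxy : (extChartAt I x).symm y ∈ (extChartAt I x').source) (α : DForm I M k) :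
    chartForm I x α y =
      (chartForm I x' α (extChartAt I x' ((extChartAt I x).symm y))).compContinuousLinearMap
        (fderiv ℝ (extChartAt I x' ∘ (extChartAt I x).symm) y) := by
  have chartForm_eq := chartForm_pullback (f := id) hy contMDiffAt_id hxy α
  rwa [pullback_id] at chartForm_eq

theorem chartForm_extD_self (α : DForm I M k) (x : M) :
    chartForm I x (extD I α) (extChartAt I x x) =
      extDeriv (chartForm I x α) (extChartAt I x x) := by
  refine chartForm_of_eq_ofChart ?_
  rw [extD, I.range_eq_univ, extDerivWithin_univ]

theorem chartForm_extD {α : DForm I M k} (hα : IsSmoothForm I α) (x : M) :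
    EqOn (chartForm I x (extD I α)) (extDeriv (chartForm I x α)) (extChartAt I x).target := by
  intro y hy
  have hxy := mem_extChartAt_source (I := I) ((extChartAt I x).symm y)
  have extDeriv_eq := extDeriv_chartForm_pullback (f := id) hy contMDiff_id hxy hα
  rw [pullback_id] at extDeriv_eq
  rw [extDeriv_eq, chartForm_change hy hxy, chartForm_extD_self]
  rfl

theorem IsSmoothForm.extD {α : DForm I M k} (hα : IsSmoothForm I α) : IsSmoothForm I (extD I α) :=
  isSmoothForm_iff.2 fun x y hy =>
    (contDiffAt_extDeriv (isSmoothForm_iff.1 hα x y hy)).congr_of_eventuallyEq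
      ((chartForm_extD hα x).eventuallyEq_of_mem (extChartAt_target_mem_nhds' hy))

theorem extD_pullback {f : M → M'} (hf : ContMDiff I I' ∞ f) {α : DForm I' M' k}
    (hα : IsSmoothForm I' α) : extD I (pullback I I' f α) = pullback I I' f (extD I' α) := by
  refine DForm.ext_chartForm fun x => ?_
  have hx := mem_extChartAt_target (I := I) x
  have hfx : f ((extChartAt I x).symm (extChartAt I x x)) ∈ (extChartAt I' (f x)).source := by simp
  rw [chartForm_extD_self, extDeriv_chartForm_pullback hx hf hfx hα,
    chartForm_pullback hx hf.contMDiffAt hfx,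
    chartForm_extD hα _ ((extChartAt I' (f x)).map_source hfx)]

theorem extD_extD {α : DForm I M k} (hα : IsSmoothForm I α) : extD I (extD I α) = 0 := by
  refine DForm.ext_chartForm fun x => ?_
  have hx := mem_extChartAt_target (I := I) x
  rw [chartForm_extD_self, ((chartForm_extD hα x).eventuallyEq_of_mem
      (extChartAt_target_mem_nhds' hx)).extDeriv_eq,
    extDeriv_extDeriv_apply (isSmoothForm_iff.1 hα x _ hx) minSmoothness_two_le_infty]
  rfl

theorem extD_add {α β : DForm I M k} (hα : IsSmoothForm I α) (hβ : IsSmoothForm I β) :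
    extD I (α + β) = extD I α + extD I β := by
  refine DForm.ext_chartForm fun x => ?_
  have hx := mem_extChartAt_target (I := I) x
  rw [chartForm_extD_self, chartForm_add, chartForm_add,
    extDeriv_add ((isSmoothForm_iff.1 hα x _ hx).differentiableAt (by simp))
      ((isSmoothForm_iff.1 hβ x _ hx).differentiableAt (by simp)),
    Pi.add_apply, chartForm_extD_self, chartForm_extD_self]

theorem extD_neg (α : DForm I M k) : extD I (-α) = -extD I α := by
  refine DForm.ext_chartForm fun x => ?_
  rw [chartForm_extD_self, chartForm_neg, chartForm_neg, extDeriv_neg, Pi.neg_apply,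
    chartForm_extD_self]

end ExteriorDerivative

section Fields

variable {E H : Type*} [NormedAddCommGroup E] [NormedSpace ℝ E] [TopologicalSpace H]
  {I : ModelWithCorners ℝ E H} {M : Type*} [TopologicalSpace M] [ChartedSpace H M]
  [IsManifold I ∞ M] {x : M} {y : E} {k : ℕ}

theorem chartField_eq_mfderiv (hy : y ∈ (extChartAt I x).target) (w : VField I M) :
    chartField I x w y = mfderiv I 𝓘(ℝ, E) (extChartAt I x) ((extChartAt I x).symm y)
      (w ((extChartAt I x).symm y)) :=
  have := isManifold_one I M
  DFunLike.congr_fun (ContinuousLinearMap.inverse_eq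
    (mfderivWithin_extChartAt_symm_comp_mfderiv_extChartAt hy)
    (mfderiv_extChartAt_comp_mfderivWithin_extChartAt_symm hy)) (w ((extChartAt I x).symm y))

theorem mfderivWithin_extChartAt_symm_chartField (hy : y ∈ (extChartAt I x).target)
    (w : VField I M) :
    mfderivWithin 𝓘(ℝ, E) I (extChartAt I x).symm (range I) y (chartField I x w y : E) =
      w ((extChartAt I x).symm y) := by
  have := isManifold_one I M
  rw [chartField_eq_mfderiv hy]
  exact DFunLike.congr_fun (mfderivWithin_extChartAt_symm_comp_mfderiv_extChartAt hy)
    (w ((extChartAt I x).symm y))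

theorem trivializationAt_snd_eq_chartField {z : M} (hz : z ∈ (extChartAt I x).source)
    (w : VField I M) :
    (trivializationAt E (TangentSpace I : M → Type _) x ⟨z, w z⟩).2 =
      chartField I x w (extChartAt I x z) := by
  have := isManifold_one I M
  have hz' : z ∈ (chartAt H x).source := by simpa using hz
  rw [chartField_eq_mfderiv ((extChartAt I x).map_source hz), (extChartAt I x).left_inv hz,
    ← TangentBundle.continuousLinearMapAt_trivializationAt (𝕜 := ℝ) (I := I) hz']
  exact (congrFun ((trivializationAt E (TangentSpace I) x).coe_linearMapAt_of_mem (R := ℝ)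
    (by simpa using hz')) (w z)).symm

theorem chartForm_interior (hy : y ∈ (extChartAt I x).target) (w : VField I M)
    (α : DForm I M (k + 1)) :
    chartForm I x (interior I w α) y = (chartForm I x α y).curryLeft (chartField I x w y) := by
  let z := (extChartAt I x).symm y
  let A : E →L[ℝ] E := mfderivWithin 𝓘(ℝ, E) I (extChartAt I x).symm (range I) y
  have field_eq : A (chartField I x w y) = w z := mfderivWithin_extChartAt_symm_chartField hy w
  have insert_eq := insertVector_compContinuousLinearMap (show E [⋀^Fin (k + 1)]→L[ℝ] ℝ from α z) A
    (chartField I x w y)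
  rw [field_eq] at insert_eq
  exact insert_eq.symm

variable [I.Boundaryless]

theorem chartField_change {x' : M} (hy : y ∈ (extChartAt I x).target)
    (hxy : (extChartAt I x).symm y ∈ (extChartAt I x').source) (w : VField I M) :
    fderiv ℝ (extChartAt I x' ∘ (extChartAt I x).symm) y (chartField I x w y) =
      chartField I x' w (extChartAt I x' ((extChartAt I x).symm y)) := by
  have mfderiv_symm := mfderivWithin_extChartAt_symm_chartField hy w
  rw [I.range_eq_univ, mfderivWithin_univ] at mfderiv_symm
  rw [chartField_eq_mfderiv ((extChartAt I x').map_source hxy), (extChartAt I x').left_inv hxy,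
    ← mfderiv_eq_fderiv]
  refine (DFunLike.congr_fun (mfderiv_comp y
    ((contMDiffAt_extChartAt_of_mem_source hxy).mdifferentiableAt (by simp))
    ((contMDiffAt_extChartAt_symm hy).mdifferentiableAt (by simp))) (chartField I x w y)).trans ?_
  exact congrArg (mfderiv I 𝓘(ℝ, E) (extChartAt I x') ((extChartAt I x).symm y)) mfderiv_symm

theorem isSmoothField_iff {w : VField I M} :
    IsSmoothField I w ↔
      ∀ x, ∀ y ∈ (extChartAt I x).target, ContDiffAt ℝ ∞ (chartField I x w) y :=
  have := isManifold_one I M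
  contMDiff_section_iff (fun x z hz => by simpa using hz)
    fun _ _ hz => trivializationAt_snd_eq_chartField hz w

theorem IsSmoothForm.interior {w : VField I M} (hw : IsSmoothField I w) {α : DForm I M (k + 1)}
    (hα : IsSmoothForm I α) : IsSmoothForm I (interior I w α) :=
  isSmoothForm_iff.2 fun x y hy =>
    (contDiffAt_curryLeft (isSmoothForm_iff.1 hα x y hy)
      (isSmoothField_iff.1 hw x y hy)).congr_of_eventuallyEq
        (EqOn.eventuallyEq_of_mem (fun _ hu => chartForm_interior hu w α)
          (extChartAt_target_mem_nhds' hy))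

theorem chartForm_lieD_self (w : VField I M) (α : DForm I M k) (x : M) :
    chartForm I x (lieD I w α) (extChartAt I x x) =
      lieDeriv (chartField I x w) (chartForm I x α) (extChartAt I x x) := by
  refine chartForm_of_eq_ofChart ?_
  rw [lieD, I.range_eq_univ, fderivWithin_univ, fderivWithin_univ, lieDeriv]

theorem extD_interior_add_interior_extD {w : VField I M} (hw : IsSmoothField I w)
    {α : DForm I M (k + 1)} (hα : IsSmoothForm I α) :
    extD I (interior I w α) + interior I w (extD I α) = lieD I w α := by
  refine DForm.ext_chartForm fun x => ?_
  have hx := mem_extChartAt_target (I := I) x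
  have chartForm_interior_eq : chartForm I x (interior I w α) =ᶠ[𝓝 (extChartAt I x x)]
      fun y => (chartForm I x α y).curryLeft (chartField I x w y) :=
    EqOn.eventuallyEq_of_mem (fun _ hu => chartForm_interior hu w α)
      (extChartAt_target_mem_nhds' hx)
  rw [chartForm_add, Pi.add_apply, chartForm_extD_self, chartForm_interior hx,
    chartForm_extD_self, chartForm_interior_eq.extDeriv_eq, chartForm_lieD_self]
  exact extDeriv_curryLeft_add_curryLeft_extDeriv
    ((isSmoothField_iff.1 hw x _ hx).differentiableAt (by simp))
    ((isSmoothForm_iff.1 hα x _ hx).differentiableAt (by simp))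

theorem lieD_add (w : VField I M) {α β : DForm I M k} (hα : IsSmoothForm I α)
    (hβ : IsSmoothForm I β) : lieD I w (α + β) = lieD I w α + lieD I w β := by
  refine DForm.ext_chartForm fun x => ?_
  have hx := mem_extChartAt_target (I := I) x
  rw [chartForm_lieD_self, chartForm_add, chartForm_add,
    lieDeriv_add _ ((isSmoothForm_iff.1 hα x _ hx).differentiableAt (by simp))
      ((isSmoothForm_iff.1 hβ x _ hx).differentiableAt (by simp)),
    Pi.add_apply, chartForm_lieD_self, chartForm_lieD_self]

theorem lieD_neg (w : VField I M) (α : DForm I M k) : lieD I w (-α) = -lieD I w α := by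
  refine DForm.ext_chartForm fun x => ?_
  rw [chartForm_lieD_self, chartForm_neg, chartForm_neg, lieDeriv_neg, Pi.neg_apply,
    chartForm_lieD_self]

end Fields

section BundleCharts

variable {E H : Type*} [NormedAddCommGroup E] [NormedSpace ℝ E] [TopologicalSpace H]
  {I : ModelWithCorners ℝ E H} {N : Type*} [TopologicalSpace N] [ChartedSpace H N] {k m : ℕ}
  {p q : FormBundle I N k} {z : E × (E [⋀^Fin k]→L[ℝ] ℝ)}

theorem mem_formBundle_chart_target [IsManifold I ∞ N] :
    z ∈ (extChartAt (formModel I k) p).target ↔ z.1 ∈ (extChartAt I p.proj).target := by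
  have base_subset (h : z.1 ∈ (extChartAt I p.proj).target) :
      (extChartAt I p.proj).symm z.1 ∈ (chartAt H p.proj).source :=
    extChartAt_source I p.proj ▸ (extChartAt I p.proj).map_target h
  rw [FiberBundle.extChartAt_target]
  exact ⟨fun h => h.1.1,
    fun h => ⟨⟨h, by simpa using base_subset h, mem_univ _⟩, mem_univ _⟩⟩

theorem mem_formBundle_chart_source [IsManifold I ∞ N] :
    q ∈ (extChartAt (formModel I k) p).source ↔ q.proj ∈ (extChartAt I p.proj).source := by
  rw [extChartAt_source, extChartAt_source, FiberBundle.chartedSpace_chartAt]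
  simp only [mfld_simps]
  exact ⟨fun h => h.1.1, fun h => ⟨⟨h, mem_univ _⟩, h⟩⟩

/-- Extending a point of the bundle to a form, smooth or not, lets `chartForm` compute the bundle
coordinates of that point. -/
theorem exists_form_apply_eq (q : FormBundle I N k) : ∃ α : DForm I N k, α q.proj = q.2 := by
  classical
  exact ⟨Function.update (fun _ => 0) q.proj q.2, Function.update_self ..⟩

variable [IsManifold I ∞ N]

theorem formBundle_chart_apply (hq : q ∈ (extChartAt (formModel I k) p).source) {α : DForm I N k}
    (hα : α q.proj = q.2) :
    extChartAt (formModel I k) p q =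
      (extChartAt I p.proj q.proj, chartForm I p.proj α (extChartAt I p.proj q.proj)) := by
  rw [← trivializationAt_snd_eq_chartForm (mem_formBundle_chart_source.1 hq) α, hα,
    FiberBundle.extChartAt]
  rfl

theorem formBundle_chart_fst (hq : q ∈ (extChartAt (formModel I k) p).source) :
    (extChartAt (formModel I k) p q).1 = extChartAt I p.proj q.proj := by
  obtain ⟨α, hα⟩ := exists_form_apply_eq q
  rw [formBundle_chart_apply hq hα]

theorem proj_formBundle_chart_symm (hz : z ∈ (extChartAt (formModel I k) p).target) :
    ((extChartAt (formModel I k) p).symm z).proj = (extChartAt I p.proj).symm z.1 := by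
  have source := (extChartAt (formModel I k) p).map_target hz
  have fst_eq := formBundle_chart_fst source
  rw [(extChartAt (formModel I k) p).right_inv hz] at fst_eq
  rw [fst_eq, (extChartAt I p.proj).left_inv (mem_formBundle_chart_source.1 source)]

theorem chartForm_eq_snd (hz : z ∈ (extChartAt (formModel I k) p).target) {α : DForm I N k}
    (hα : α ((extChartAt (formModel I k) p).symm z).proj =
      ((extChartAt (formModel I k) p).symm z).2) :
    chartForm I p.proj α z.1 = z.2 := by
  have coordinates := formBundle_chart_apply ((extChartAt (formModel I k) p).map_target hz) hα
  rw [(extChartAt (formModel I k) p).right_inv hz, proj_formBundle_chart_symm hz,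
    (extChartAt I p.proj).right_inv (mem_formBundle_chart_target.1 hz)] at coordinates
  exact (congrArg Prod.snd coordinates).symm

theorem contMDiff_formBundle_proj : ContMDiff (formModel I k) I ∞ (proj I N k) :=
  contMDiff_proj _

variable [I.Boundaryless]

theorem chartForm_pullback_proj (p : FormBundle I N k) (α : DForm I N m) :
    EqOn (chartForm (formModel I k) p (pullback (formModel I k) I (proj I N k) α))
      (fun z => (chartForm I p.proj α z.1).compContinuousLinearMap
        (.fst ℝ E (E [⋀^Fin k]→L[ℝ] ℝ))) (extChartAt (formModel I k) p).target := by
  intro z hz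
  have proj_inCharts : EqOn (extChartAt I p.proj ∘ proj I N k ∘ (extChartAt (formModel I k) p).symm)
      Prod.fst (extChartAt (formModel I k) p).target := by
    intro u hu
    rw [Function.comp_apply, Function.comp_apply, proj, proj_formBundle_chart_symm hu,
      (extChartAt I p.proj).right_inv (mem_formBundle_chart_target.1 hu)]
  have proj_source : proj I N k ((extChartAt (formModel I k) p).symm z) ∈
      (extChartAt I p.proj).source :=
    mem_formBundle_chart_source.1 ((extChartAt (formModel I k) p).map_target hz)
  rw [chartForm_pullback hz contMDiff_formBundle_proj.contMDiffAt proj_source,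
    (proj_inCharts.eventuallyEq_of_mem (extChartAt_target_mem_nhds' hz)).fderiv_eq, fderiv_fst]
  exact congrArg (fun y => (chartForm I p.proj α y).compContinuousLinearMap _) (proj_inCharts hz)

theorem chartForm_tautologicalForm (p : FormBundle I N k) :
    EqOn (chartForm (formModel I k) p (tautologicalForm I N k)) (modelTautologicalForm E k)
      (extChartAt (formModel I k) p).target := by
  intro z hz
  obtain ⟨α, hα⟩ := exists_form_apply_eq ((extChartAt (formModel I k) p).symm z)
  calc
    _ = chartForm (formModel I k) p (pullback (formModel I k) I (proj I N k) α) z := by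
      simp only [chartForm, tautologicalForm, pullback, proj, hα]
      rfl
    _ = (chartForm I p.proj α z.1).compContinuousLinearMap _ := chartForm_pullback_proj p α hz
    _ = _ := by rw [chartForm_eq_snd hz hα, modelTautologicalForm_apply]

theorem isSmoothForm_tautologicalForm :
    IsSmoothForm (formModel I k) (tautologicalForm I N k) :=
  isSmoothForm_iff.2 fun p _ hz =>
    (modelTautologicalForm E k).contDiff.contDiffAt.congr_of_eventuallyEq
      ((chartForm_tautologicalForm p).eventuallyEq_of_mem (extChartAt_target_mem_nhds' hz))

theorem isSmoothForm_theta_add_pullback_proj {b : DForm I N k} (hb : IsSmoothForm I b) :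
    IsSmoothForm (formModel I k) (theta I N k + pullback (formModel I k) I (proj I N k) b) :=
  isSmoothForm_tautologicalForm.neg.add (hb.pullback contMDiff_formBundle_proj)

theorem formBundle_chart_change (hz : z ∈ (extChartAt (formModel I k) q).target)
    (hzp : (extChartAt I q.proj).symm z.1 ∈ (extChartAt I p.proj).source) :
    extChartAt (formModel I k) p ((extChartAt (formModel I k) q).symm z) =
      ((extChartAt I p.proj ∘ (extChartAt I q.proj).symm) z.1,
        z.2.compContinuousLinearMap (fderiv ℝ (extChartAt I q.proj ∘ (extChartAt I p.proj).symm)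
          ((extChartAt I p.proj ∘ (extChartAt I q.proj).symm) z.1))) := by
  obtain ⟨α, hα⟩ := exists_form_apply_eq ((extChartAt (formModel I k) q).symm z)
  have proj_symm := proj_formBundle_chart_symm hz
  have hz1 := mem_formBundle_chart_target.1 hz
  rw [formBundle_chart_apply (mem_formBundle_chart_source.2 (by rwa [proj_symm])) hα, proj_symm,
    chartForm_change (x := p.proj) (x' := q.proj) ((extChartAt I p.proj).map_source hzp)
      (by rw [(extChartAt I p.proj).left_inv hzp]; exact (extChartAt I q.proj).map_target hz1),
    (extChartAt I p.proj).left_inv hzp, (extChartAt I q.proj).right_inv hz1,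
    chartForm_eq_snd hz hα]
  rfl

end BundleCharts

section CanonicalLift

variable {E H : Type*} [NormedAddCommGroup E] [NormedSpace ℝ E] [TopologicalSpace H]
  {I : ModelWithCorners ℝ E H} [I.Boundaryless]
  {N : Type*} [TopologicalSpace N] [ChartedSpace H N] [IsManifold I ∞ N] {k m : ℕ}
  {w : VField I N}

theorem fderiv_chart_change_modelLift (hw : IsSmoothField I w) {p q : FormBundle I N k}
    {z : E × (E [⋀^Fin k]→L[ℝ] ℝ)} (hz : z ∈ (extChartAt (formModel I k) q).target)
    (hzp : (extChartAt I q.proj).symm z.1 ∈ (extChartAt I p.proj).source) :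
    fderiv ℝ (extChartAt (formModel I k) p ∘ (extChartAt (formModel I k) q).symm) z
        (modelLift (chartField I q.proj w) z) =
      modelLift (chartField I p.proj w)
        (extChartAt (formModel I k) p ((extChartAt (formModel I k) q).symm z)) := by
  have hz1 := mem_formBundle_chart_target.1 hz
  let y' : E := extChartAt I p.proj ((extChartAt I q.proj).symm z.1)
  have hy' : y' ∈ (extChartAt I p.proj).target := (extChartAt I p.proj).map_source hzp
  have symm_y' : (extChartAt I p.proj).symm y' = (extChartAt I q.proj).symm z.1 :=
    (extChartAt I p.proj).left_inv hzp
  have hy'q : (extChartAt I p.proj).symm y' ∈ (extChartAt I q.proj).source := by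
    rw [symm_y']
    exact (extChartAt I q.proj).map_target hz1
  have near_y' := eventually_mem_source_inCharts (f := id) hy' continuousAt_id hy'q
  have chart_change_eq : extChartAt (formModel I k) p ∘ (extChartAt (formModel I k) q).symm
      =ᶠ[𝓝 z] fun u => ((extChartAt I p.proj ∘ (extChartAt I q.proj).symm) u.1,
        u.2.compContinuousLinearMap (fderiv ℝ (extChartAt I q.proj ∘ (extChartAt I p.proj).symm)
          ((extChartAt I p.proj ∘ (extChartAt I q.proj).symm) u.1))) := by
    filter_upwards [continuous_fst.continuousAt.eventually
      (eventually_mem_source_inCharts (f := id) hz1 continuousAt_id hzp)] with u hu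
    exact formBundle_chart_change (mem_formBundle_chart_target.2 hu.1) hu.2
  rw [chart_change_eq.fderiv_eq, formBundle_chart_change hz hzp]
  refine fderiv_apply_modelLift
    (contDiffAt_inCharts (f := id) hz1 contMDiffAt_id hzp)
    (contDiffAt_inCharts (f := id) hy' contMDiffAt_id hy'q) ?_ ?_
    ((isSmoothField_iff.1 hw _ _ hz1).differentiableAt (by simp))
    ((isSmoothField_iff.1 hw _ _ hy').differentiableAt (by simp)) ?_
  · exact (congrArg (extChartAt I q.proj) symm_y').trans ((extChartAt I q.proj).right_inv hz1)
  · filter_upwards [near_y'] with y hy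
    exact (congrArg (extChartAt I p.proj) ((extChartAt I q.proj).left_inv hy.2)).trans
      ((extChartAt I p.proj).right_inv hy.1)
  · filter_upwards [near_y'] with y hy
    exact (chartField_change hy.1 hy.2 w).symm

theorem chartField_canonicalLift_self (w : VField I N) (q : FormBundle I N k) :
    chartField (formModel I k) q (canonicalLift I k w) (extChartAt (formModel I k) q q) =
      modelLift (chartField I q.proj w) (extChartAt (formModel I k) q q) := by
  have := isManifold_one (formModel I k) (FormBundle I N k)
  have hq := mem_extChartAt_target (I := formModel I k) q
  have canonicalLift_eq : canonicalLift I k w q =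
      mfderivWithin 𝓘(ℝ, E × (E [⋀^Fin k]→L[ℝ] ℝ)) (formModel I k)
        (extChartAt (formModel I k) q).symm (range (formModel I k))
        (extChartAt (formModel I k) q q)
        (modelLift (chartField I q.proj w) (extChartAt (formModel I k) q q) :
          E × (E [⋀^Fin k]→L[ℝ] ℝ)) := by
    simp only [canonicalLift, I.range_eq_univ, fderivWithin_univ]
    rfl
  have mfderiv_comp_symm := mfderiv_extChartAt_comp_mfderivWithin_extChartAt_symm hq
  rw [extChartAt_to_inv] at mfderiv_comp_symm
  rw [chartField_eq_mfderiv hq, extChartAt_to_inv]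
  exact (congrArg (mfderiv (formModel I k) 𝓘(ℝ, E × (E [⋀^Fin k]→L[ℝ] ℝ))
    (extChartAt (formModel I k) q) q) canonicalLift_eq).trans
      (DFunLike.congr_fun mfderiv_comp_symm
        (modelLift (chartField I q.proj w) (extChartAt (formModel I k) q q)))

theorem chartField_canonicalLift (hw : IsSmoothField I w) (p : FormBundle I N k) :
    EqOn (chartField (formModel I k) p (canonicalLift I k w)) (modelLift (chartField I p.proj w))
      (extChartAt (formModel I k) p).target := by
  intro z hz
  obtain ⟨q, hq, rfl⟩ := (extChartAt (formModel I k) p).surjOn hz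
  have hqq := mem_extChartAt_target (I := formModel I k) q
  have hqp : (extChartAt I q.proj).symm (extChartAt (formModel I k) q q).1 ∈
      (extChartAt I p.proj).source := by
    rw [← proj_formBundle_chart_symm hqq, extChartAt_to_inv]
    exact mem_formBundle_chart_source.1 hq
  have field_change := chartField_change (x' := p) hqq (by rwa [extChartAt_to_inv])
    (canonicalLift I k w)
  rw [chartField_canonicalLift_self, fderiv_chart_change_modelLift hw hqq hqp,
    extChartAt_to_inv] at field_change
  exact field_change.symm

theorem isSmoothField_canonicalLift (hw : IsSmoothField I w) :
    IsSmoothField (formModel I k) (canonicalLift I k w) :=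
  isSmoothField_iff.2 fun p _ hz =>
    (contDiffAt_modelLift
      (isSmoothField_iff.1 hw _ _ (mem_formBundle_chart_target.1 hz))).congr_of_eventuallyEq
        ((chartField_canonicalLift hw p).eventuallyEq_of_mem (extChartAt_target_mem_nhds' hz))

theorem lieD_canonicalLift_tautologicalForm (hw : IsSmoothField I w) :
    lieD (formModel I k) (canonicalLift I k w) (tautologicalForm I N k) = 0 := by
  refine DForm.ext_chartForm fun p => ?_
  have hp := mem_extChartAt_target (I := formModel I k) p
  have near_p := extChartAt_target_mem_nhds' hp
  rw [chartForm_lieD_self,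
    lieDeriv_congr ((chartField_canonicalLift hw p).eventuallyEq_of_mem near_p)
      ((chartForm_tautologicalForm p).eventuallyEq_of_mem near_p),
    lieDeriv_modelLift_modelTautologicalForm
      (isSmoothField_iff.1 hw _ _ (mem_formBundle_chart_target.1 hp))]
  rfl

theorem lieD_canonicalLift_pullback (hw : IsSmoothField I w) {b : DForm I N m}
    (hb : IsSmoothForm I b) :
    lieD (formModel I k) (canonicalLift I k w) (pullback (formModel I k) I (proj I N k) b) =
      pullback (formModel I k) I (proj I N k) (lieD I w b) := by
  refine DForm.ext_chartForm fun p => ?_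
  have hp := mem_extChartAt_target (I := formModel I k) p
  have hp1 := mem_formBundle_chart_target.1 hp
  have near_p := extChartAt_target_mem_nhds' hp
  rw [chartForm_lieD_self,
    lieDeriv_congr ((chartField_canonicalLift hw p).eventuallyEq_of_mem near_p)
      ((chartForm_pullback_proj p b).eventuallyEq_of_mem near_p),
    lieDeriv_modelLift_comp_fst (isSmoothField_iff.1 hw _ _ hp1)
      ((isSmoothForm_iff.1 hb _ _ hp1).differentiableAt (by simp)),
    chartForm_pullback_proj p _ hp]
  beta_reduce
  rw [formBundle_chart_fst (mem_extChartAt_source p), chartForm_lieD_self]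

end CanonicalLift

section MagneticForm

variable {E H : Type*} [NormedAddCommGroup E] [NormedSpace ℝ E] [TopologicalSpace H]
  {I : ModelWithCorners ℝ E H} [I.Boundaryless]
  {N : Type*} [TopologicalSpace N] [ChartedSpace H N] [IsManifold I ∞ N] {k : ℕ}

theorem magneticForm_eq_extD {b : DForm I N k} (hb : IsSmoothForm I b) :
    magneticForm b = extD (formModel I k)
      (theta I N k + pullback (formModel I k) I (proj I N k) b) := by
  rw [theta, extD_add isSmoothForm_tautologicalForm.neg (hb.pullback contMDiff_formBundle_proj),
    extD_pullback contMDiff_formBundle_proj hb, magneticForm, theta]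

theorem isPrePlectic_magneticForm {b : DForm I N k} (hb : IsSmoothForm I b) :
    IsPrePlectic (formModel I k) (magneticForm b) := by
  rw [magneticForm_eq_extD hb]
  exact ⟨(isSmoothForm_theta_add_pullback_proj hb).extD,
    extD_extD (isSmoothForm_theta_add_pullback_proj hb)⟩

theorem curryLeft_chartForm_magneticForm (b : DForm I N (k + 1)) (p : FormBundle I N (k + 1))
    (ζ : E [⋀^Fin (k + 1)]→L[ℝ] ℝ) :
    (chartForm (formModel I (k + 1)) p (magneticForm b)
      (extChartAt (formModel I (k + 1)) p p)).curryLeft (0, ζ) =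
        -ζ.compContinuousLinearMap (.fst ℝ E (E [⋀^Fin (k + 1)]→L[ℝ] ℝ)) := by
  have hp := mem_extChartAt_target (I := formModel I (k + 1)) p
  have tautologicalForm_near_p :=
    (chartForm_tautologicalForm p).eventuallyEq_of_mem (extChartAt_target_mem_nhds' hp)
  rw [magneticForm, theta, extD_neg, chartForm_add, chartForm_neg, Pi.add_apply, Pi.neg_apply,
    chartForm_extD_self, chartForm_pullback_proj p _ hp, tautologicalForm_near_p.extDeriv_eq,
    ← curryLeft_extDeriv_modelTautologicalForm (extChartAt (formModel I (k + 1)) p p) ζ]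
  refine (DFunLike.congr_fun (curryLeft_add _ _) _).trans ?_
  rw [_root_.add_apply, curryLeft_compContinuousLinearMap_fst, add_zero]
  rfl

theorem isPlectic_magneticForm {b : DForm I N (k + 1)} (hb : IsSmoothForm I b)
    (hk : ((k + 1 : ℕ) : Cardinal) ≤ Module.rank ℝ E) :
    IsPlectic (formModel I (k + 1)) (magneticForm b) where
  toIsPrePlectic := isPrePlectic_magneticForm hb
  nondegenerate p := injective_insertVector_of_chartForm
    (injective_curryLeft_of_vertical hk (curryLeft_chartForm_magneticForm b p))

theorem lieD_canonicalLift_theta_add_pullback {b : DForm I N k} (hb : IsSmoothForm I b)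
    {w : VField I N} (hw : IsSmoothField I w) :
    lieD (formModel I k) (canonicalLift I k w)
        (theta I N k + pullback (formModel I k) I (proj I N k) b) =
      pullback (formModel I k) I (proj I N k) (lieD I w b) := by
  rw [theta, lieD_add _ isSmoothForm_tautologicalForm.neg (hb.pullback contMDiff_formBundle_proj),
    lieD_neg, lieD_canonicalLift_tautologicalForm hw, neg_zero, zero_add,
    lieD_canonicalLift_pullback hw hb]

theorem isHamiltonianField_canonicalLift {b : DForm I N (k + 1)} (hb : IsSmoothForm I b)
    {w : VField I N} (hw : IsSmoothField I w) {a : DForm I N k} (ha : IsSmoothForm I a)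
    (hab : lieD I w b = extD I a) :
    IsHamiltonianField (formModel I (k + 1)) (magneticForm b)
      (magneticHamiltonian w b a) (canonicalLift I (k + 1) w) := by
  have proj_smooth := contMDiff_formBundle_proj (I := I) (N := N) (k := k + 1)
  have lift_smooth := isSmoothField_canonicalLift (k := k + 1) hw
  have pullback_smooth := (ha.pullback proj_smooth).neg
  have potential_smooth := isSmoothForm_theta_add_pullback_proj hb
  refine ⟨pullback_smooth.add (potential_smooth.interior lift_smooth), lift_smooth, ?_⟩
  have cartan := extD_interior_add_interior_extD lift_smooth potential_smooth
  rw [lieD_canonicalLift_theta_add_pullback hb hw, hab, ← magneticForm_eq_extD hb] at cartan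
  rw [magneticHamiltonian, extD_add pullback_smooth (potential_smooth.interior lift_smooth),
    extD_neg, extD_pullback proj_smooth ha, ← cartan]
  abel

end MagneticForm

end Multisymplectic

theorem mainTheorem12_general {E H : Type*} [NormedAddCommGroup E] [NormedSpace ℝ E]
    [TopologicalSpace H] {I : ModelWithCorners ℝ E H} [I.Boundaryless] {N : Type*}
    [TopologicalSpace N] [ChartedSpace H N] [IsManifold I ∞ N] (k : ℕ)
    (b : DForm I N (k + 1)) (hb : IsSmoothForm I b) (w : VField I N) (hw : IsSmoothField I w)
    (a : DForm I N k) (ha : IsSmoothForm I a) (hab : lieD I w b = extD I a) :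
    IsPrePlectic (formModel I (k + 1)) (magneticForm b) ∧
      (((k + 1 : ℕ) : Cardinal) ≤ Module.rank ℝ E →
        IsPlectic (formModel I (k + 1)) (magneticForm b)) ∧
      IsHamiltonianField (formModel I (k + 1)) (magneticForm b)
        (magneticHamiltonian w b a) (canonicalLift I (k + 1) w) :=
  ⟨isPrePlectic_magneticForm hb, isPlectic_magneticForm hb,
    isHamiltonianField_canonicalLift hb hw ha hab⟩

theorem mainTheorem12 {E : Type*} [NormedAddCommGroup E] [NormedSpace ℝ E]
    [FiniteDimensional ℝ E] {N : Type*} [TopologicalSpace N] [ChartedSpace E N]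
    [IsManifold 𝓘(ℝ, E) ∞ N] (k : ℕ)
    (b : DForm 𝓘(ℝ, E) N (k + 1)) (hb : IsSmoothForm 𝓘(ℝ, E) b)
    (w : VField 𝓘(ℝ, E) N) (hw : IsSmoothField 𝓘(ℝ, E) w)
    (a : DForm 𝓘(ℝ, E) N k) (ha : IsSmoothForm 𝓘(ℝ, E) a)
    (hab : lieD 𝓘(ℝ, E) w b = extD 𝓘(ℝ, E) a) :
    IsPrePlectic (formModel 𝓘(ℝ, E) (k + 1)) (magneticForm b) ∧
      (k + 1 ≤ Module.finrank ℝ E →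
        IsPlectic (formModel 𝓘(ℝ, E) (k + 1)) (magneticForm b)) ∧
      IsHamiltonianField (formModel 𝓘(ℝ, E) (k + 1)) (magneticForm b)
        (magneticHamiltonian w b a) (canonicalLift 𝓘(ℝ, E) (k + 1) w) := by
  simpa only [← Module.finrank_eq_rank, Nat.cast_le] using
    mainTheorem12_general k b hb w hw a ha hab
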